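/- Let $\sigma_1=\begin{bmatrix}0&1\\1&0\end{bmatrix}$, $\sigma_2=\begin{bmatrix}0&-i\\i&0\end{bmatrix}$, $\sigma_3=\begin{bmatrix}1&0\\0&-1\end{bmatrix}$, $\breve J=(-i\sigma_2)^{-1}=\begin{bmatrix}0&1\\-1&0\end{bmatrix}$, $q_1=-\breve J$ and $\breve K=\frac1{\sqrt2}\begin{bmatrix}1&1\\-i&i\end{bmatrix}$. Fix $\kappa\in\mathbb Z$, put $\varkappa=|\kappa|$, and fix an integer $m>0$, complex $m\times m$ matrices $\mathcal A_1$ and $\mathcal S_1>0$, a lower triangular complex $\varkappa\times\varkappa$ matrix $\mathcal A_2$, and an $(m+\varkappa)\times2$ matrix $\Pi(0)=\begin{bmatrix}\Psi_1(0)\\ \Psi_2(0)\end{bmatrix}$ with blocks of size $m\times2$ and $\varkappa\times2$, such that $$\mathcal A_1\mathcal S_1-\mathcal S_1\mathcal A_1^*=\Psi_1(0)\breve J\Psi_1(0)^*,\qquad \Psi_2(0)\breve J\Psi_2(0)^*=0.$$ Let $c\ne0$ and assume that the first row of $\Psi_2(0)$ equals $c\,[0\ \ 1]$ if $\kappa$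 is positive and odd or negative and even, and equals $c\,[1\ \ 0]$ if $\kappa$ is positive and even or negative and odd (no condition if $\kappa=0$, when the lower blocks are empty). Put $$A=\begin{bmatrix}\mathcal A_1&0\\R&\mathcal A_2\end{bmatrix},\quad R=\Psi_2(0)\breve J\Psi_1(0)^*\mathcal S_1^{-1},\quad [\theta_1\ \ \theta_2]=\Pi(0)\breve K,$$ $$\Pi(x)=[e^{ixA}\theta_1\ \ e^{-ixA}\theta_2]\breve K^*,\quad S(x)=\begin{bmatrix}\mathcal S_1&0\\0&0\end{bmatrix}+\int_0^x\Big(e^{itA}\theta_1\theta_1^*e^{-itA^*}+e^{-itA}\theta_2\theta_2^*e^{itA^*}\Big)dt.$$ Assume that $S(x)>0$ for all $x>0$, and put, for $x>0$, $$X=\{X_{ij}\}_{i,j=1}^2=\Pi^*S^{-1}\Pi,\quad \widetilde q_0=\breve JX\breve J^*-X,\quad w_A(x,\lambda)=I_2-\breve J\,\Pi(x)^*S(x)^{-1}(A-\lambda I)^{-1}\Pi(x).$$ Then for $x>0$ $$\widetilde q_0(x)=\frac{\kappa}{x}\sigma_3+\Upsilon(x)=\frac{\kappa}{x}\sigma_3+\widetilde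 v_a(x)\sigma_3-\widetilde v_s(x)\sigma_1,\qquad \widetilde v_a=X_{22}-X_{11}-\frac{\kappa}{x},\quad \widetilde v_s=X_{12}+X_{21},$$ where $\widetilde v_a,\widetilde v_s$ are real-valued and locally integrable on $[0,\infty)$, and $\Upsilon$, $\widetilde v_a$, $\widetilde v_s$ are bounded on some interval $(0,\varepsilon)$, $\varepsilon>0$. Moreover, for every $\lambda\in\mathbb C\setminus\sigma(A)$ the $2\times2$ matrix function $$\widetilde u(x,\lambda)=w_A(x,\lambda)\,\breve K\,e^{-i\lambda x\sigma_3}$$ satisfies, for $x>0$, $$\Big(\frac{d}{dx}+\lambda q_1+\widetilde q_0(x)\Big)\widetilde u(x,\lambda)=0,$$ equivalently the radial Dirac equation $$\Big(-i\sigma_2\frac{d}{dx}+\frac{\kappa}{x}\sigma_1+\widetilde v_a(x)\sigma_1+\widetilde v_s(x)\sigma_3\Big)\widetilde u=\lambda\widetilde u,$$ and if also $\lambda\notin\sigma(A^*)$, then $\det\widetilde u(x,\lambda)\neq0$ for all $x>0$, i.e. $\widetilde u$ is a fundamental solution. -/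

import Mathlib

open scoped ComplexOrder

namespace RadialDirac

noncomputable section

/-- Pauli matrices. -/
def sigma1 : Matrix (Fin 2) (Fin 2) ℂ := !![0, 1; 1, 0]

def sigma2 : Matrix (Fin 2) (Fin 2) ℂ := !![0, -Complex.I; Complex.I, 0]

def sigma3 : Matrix (Fin 2) (Fin 2) ℂ := !![1, 0; 0, -1]

/-- The matrix `J̆ = (-i σ₂)⁻¹`. -/
def Jb : Matrix (Fin 2) (Fin 2) ℂ := !![0, 1; -1, 0]

theorem Jb_eq : Jb = ((-Complex.I) • sigma2)⁻¹ := by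
  symm
  apply Matrix.inv_eq_right_inv
  ext i j
  fin_cases i <;> fin_cases j <;> simp [sigma2, Jb, Matrix.mul_apply, Fin.sum_univ_two]

/-- The coefficient `q₁ = -J̆` of the spectral parameter. -/
def q1 : Matrix (Fin 2) (Fin 2) ℂ := -Jb

/-- The unitary matrix `K̆`. -/
def Kb : Matrix (Fin 2) (Fin 2) ℂ :=
  ((Real.sqrt 2 : ℂ)⁻¹) • !![1, 1; -Complex.I, Complex.I]

/-- The row `[1 0 0 … 0] Ψ` (it is the zero row when `Ψ` has no rows). -/
def topRow {k : ℕ} (Ψ : Matrix (Fin k) (Fin 2) ℂ) : Fin 2 → ℂ :=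
  Matrix.vecMul (fun i : Fin k => if (i : ℕ) = 0 then (1 : ℂ) else 0) Ψ

/-- The block lower triangular matrix `A` with lower left block `R = Ψ₂ J̆ Ψ₁* S₁⁻¹`. -/
def blockA {m k : ℕ} (A₁ S₁ : Matrix (Fin m) (Fin m) ℂ) (A₂ : Matrix (Fin k) (Fin k) ℂ)
    (Ψ₁ : Matrix (Fin m) (Fin 2) ℂ) (Ψ₂ : Matrix (Fin k) (Fin 2) ℂ) :
    Matrix (Fin m ⊕ Fin k) (Fin m ⊕ Fin k) ℂ :=
  Matrix.fromBlocks A₁ 0 (Ψ₂ * Jb * Ψ₁.conjTranspose * S₁⁻¹) A₂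

/-- The initial value `Π(0)`, with upper block `Ψ₁` and lower block `Ψ₂`. -/
def blockPi {m k : ℕ} (Ψ₁ : Matrix (Fin m) (Fin 2) ℂ) (Ψ₂ : Matrix (Fin k) (Fin 2) ℂ) :
    Matrix (Fin m ⊕ Fin k) (Fin 2) ℂ :=
  Matrix.fromRows Ψ₁ Ψ₂

/-- The initial value `S(0) = diag (S₁, 0)`. -/
def blockS {m : ℕ} (k : ℕ) (S₁ : Matrix (Fin m) (Fin m) ℂ) :
    Matrix (Fin m ⊕ Fin k) (Fin m ⊕ Fin k) ℂ :=
  Matrix.fromBlocks S₁ 0 0 0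

section General

variable {n : Type} [Fintype n] [DecidableEq n]

/-- The columns of `[θ₁ θ₂] = Π(0) K̆` (column index `0` is `θ₁`, column index `1` is `θ₂`). -/
def theta (P₀ : Matrix n (Fin 2) ℂ) (j : Fin 2) : n → ℂ := fun i => (P₀ * Kb) i j

/-- `Π(x) = [e^{ixA} θ₁   e^{-ixA} θ₂] K̆*`. -/
def PiFun (A : Matrix n n ℂ) (P₀ : Matrix n (Fin 2) ℂ) (x : ℝ) : Matrix n (Fin 2) ℂ :=
  (Matrix.of fun i =>
    ![((NormedSpace.exp ((Complex.I * (x : ℂ)) • A)).mulVec (theta P₀ 0)) i,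
      ((NormedSpace.exp ((-Complex.I * (x : ℂ)) • A)).mulVec (theta P₀ 1)) i]) *
    Kb.conjTranspose

/-- `e^{itA} θ₁ θ₁* e^{-itA*} + e^{-itA} θ₂ θ₂* e^{itA*}`. -/
def SDensity (A : Matrix n n ℂ) (P₀ : Matrix n (Fin 2) ℂ) (t : ℝ) : Matrix n n ℂ :=
  NormedSpace.exp ((Complex.I * (t : ℂ)) • A) *
      Matrix.vecMulVec (theta P₀ 0) (star (theta P₀ 0)) *
      NormedSpace.exp ((-Complex.I * (t : ℂ)) • A.conjTranspose) +
    NormedSpace.exp ((-Complex.I * (t : ℂ)) • A) *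
      Matrix.vecMulVec (theta P₀ 1) (star (theta P₀ 1)) *
      NormedSpace.exp ((Complex.I * (t : ℂ)) • A.conjTranspose)

/-- `S(x) = S(0) + ∫₀ˣ SDensity(t) dt`, the integral being taken entrywise. -/
def SFun (A S₀ : Matrix n n ℂ) (P₀ : Matrix n (Fin 2) ℂ) (x : ℝ) : Matrix n n ℂ :=
  S₀ + Matrix.of fun i j => ∫ t in (0 : ℝ)..x, SDensity A P₀ t i j

/-- `X = Π* S⁻¹ Π`. -/
def XFun (A S₀ : Matrix n n ℂ) (P₀ : Matrix n (Fin 2) ℂ) (x : ℝ) :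
    Matrix (Fin 2) (Fin 2) ℂ :=
  (PiFun A P₀ x).conjTranspose * (SFun A S₀ P₀ x)⁻¹ * PiFun A P₀ x

/-- The transformed potential `q̃₀ = J̆ X J̆* - X`. -/
def qTilde (A S₀ : Matrix n n ℂ) (P₀ : Matrix n (Fin 2) ℂ) (x : ℝ) :
    Matrix (Fin 2) (Fin 2) ℂ :=
  Jb * XFun A S₀ P₀ x * Jb.conjTranspose - XFun A S₀ P₀ x

/-- The transfer matrix function `w_A(x, z) = I₂ - J̆ Π* S⁻¹ (A - z I)⁻¹ Π`. -/
def wA (A S₀ : Matrix n n ℂ) (P₀ : Matrix n (Fin 2) ℂ) (x : ℝ) (z : ℂ) :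
    Matrix (Fin 2) (Fin 2) ℂ :=
  1 - Jb * (PiFun A P₀ x).conjTranspose * (SFun A S₀ P₀ x)⁻¹ *
    (A - z • (1 : Matrix n n ℂ))⁻¹ * PiFun A P₀ x

/-- `ũ(x, z) = w_A(x, z) K̆ exp (-i z x σ₃)`. -/
def uTilde (A S₀ : Matrix n n ℂ) (P₀ : Matrix n (Fin 2) ℂ) (x : ℝ) (z : ℂ) :
    Matrix (Fin 2) (Fin 2) ℂ :=
  wA A S₀ P₀ x z * Kb * NormedSpace.exp ((-Complex.I * z * (x : ℂ)) • sigma3)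

end General

/-- The `2 × 2` matrix function `u` is differentiable (entrywise) at every `x > 0` and solves
`(d/dx + z q₁ + q₀(x)) u = 0` for `x > 0`. -/
def SolvesSystem (q₀ : ℝ → Matrix (Fin 2) (Fin 2) ℂ) (z : ℂ)
    (u : ℝ → Matrix (Fin 2) (Fin 2) ℂ) : Prop :=
  ∀ x : ℝ, 0 < x → ∃ du : Matrix (Fin 2) (Fin 2) ℂ,
    (∀ i j, HasDerivAt (fun t => u t i j) (du i j) x) ∧
    du + (z • q1 + q₀ x) * u x = 0

/-- The `2 × 2` matrix function `u` is differentiable (entrywise) at every `x > 0` and solves the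
radial Dirac equation `(-i σ₂ d/dx + (κ/x) σ₁ + V(x)) u = z u` for `x > 0`, where
`V = v_e I₂ + v_a σ₁ + v_s σ₃`. -/
def SolvesRadialDirac (κ : ℤ) (ve va vs : ℝ → ℝ) (z : ℂ)
    (u : ℝ → Matrix (Fin 2) (Fin 2) ℂ) : Prop :=
  ∀ x : ℝ, 0 < x → ∃ du : Matrix (Fin 2) (Fin 2) ℂ,
    (∀ i j, HasDerivAt (fun t => u t i j) (du i j) x) ∧
    ((-Complex.I) • sigma2) * du +
      (((κ : ℂ) / (x : ℂ)) • sigma1 +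
        ((ve x : ℂ) • (1 : Matrix (Fin 2) (Fin 2) ℂ) + (va x : ℂ) • sigma1 +
          (vs x : ℂ) • sigma3)) * u x = z • u x

end

end RadialDirac

/-! The triple `A`, `Π`, `S` obeys `Π' = -A Π J`, `S' = Π Π*` and `A S - S A* = Π J Π*` for all `x`;
the last identity holds at `0` by the choice of `R` and propagates because its defect has zero
derivative. For `x > 0`, where `S` is invertible, these relations alone give `w_A' = λ (J w_A - w_A
J) - q̃₀ w_A`. Since `K σ₃ = i J K`, the factor `K e^{-iλxσ₃}` solves the free system, so the
Darboux-type product `w_A K e^{-iλxσ₃}` solves the transformed one. It is nonsingular because `w_A`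
has an explicit inverse built from `(A* - λ)⁻¹`.

The delicate point is the behaviour at `0`, where `S(0) = diag(S₁, 0)` is singular. The lower rows
are eliminated one at a time, starting from the last. By the Schur complement, adding a row changes
`X` by the rank one term `p* c⁻¹ p`, where the reduced row `p` and the scalar pivot `c > 0` satisfy
`p' = -a p J + p q`, `c' = |p|²`, `c → 0`, with `q` the potential of the smaller node.

If `q ~ (μ/x) σ₃`, this is a linear system with a regular singularity. The row is meromorphic at
`0`, so `p = xᵏ g` with `g(0) ≠ 0`, and comparing leading terms gives `k g(0) = μ g(0) σ₃`.
Positivity of `c` forces `k ≥ 0`; hence `k = |μ|`, and for `μ ≠ 0` the sign of `μ` decides which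
coordinate of `g(0)` survives. Then `c ~ |g(0)|² x^{2k+1}/(2k+1)`, so the rank one term has residue
`2k+1` times a coordinate projection, and the new residue is `-(μ + 1)` for `μ > 0` and `|μ| + 1`
for `μ < 0`: each row flips the sign and raises the modulus by one. Only at `μ = 0` is the direction
free, and there it is read off from the first row of `Ψ₂(0)`. After `|κ|` rows the residue is `κ σ₃`
(`IsNode.schur_step`, `IsNode.hasResidue`).

Finally, the entries of `X` are meromorphic at `0`, so knowing the limit of `x q̃₀(x)` already makes
`q̃₀ - (κ/x) σ₃` bounded near `0`. -/

namespace RadialDirac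

open Filter Topology Matrix

/-! ### Entrywise calculus and meromorphy of matrix functions -/

section MatrixCalculus

variable {l m n : Type*}

/-- Entrywise derivative of a matrix valued function of a real variable. -/
def HasMatDerivAt (F : ℝ → Matrix m n ℂ) (F' : Matrix m n ℂ) (x : ℝ) : Prop :=
  ∀ i j, HasDerivAt (fun t => F t i j) (F' i j) x

/-- Entrywise meromorphy at `0` of a matrix valued function of a real variable. -/
def MatMeromorphic (F : ℝ → Matrix m n ℂ) : Prop :=
  ∀ i j, MeromorphicAt (fun t => F t i j) (0 : ℝ)

theorem hasMatDerivAt_const (F : Matrix m n ℂ) (x : ℝ) : HasMatDerivAt (fun _ => F) 0 x :=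
  fun i j => hasDerivAt_const x (F i j)

theorem HasMatDerivAt.add {F G : ℝ → Matrix m n ℂ} {F' G' : Matrix m n ℂ} {x : ℝ}
    (hF : HasMatDerivAt F F' x) (hG : HasMatDerivAt G G' x) :
    HasMatDerivAt (fun t => F t + G t) (F' + G') x :=
  fun i j => (hF i j).add (hG i j)

theorem HasMatDerivAt.sub {F G : ℝ → Matrix m n ℂ} {F' G' : Matrix m n ℂ} {x : ℝ}
    (hF : HasMatDerivAt F F' x) (hG : HasMatDerivAt G G' x) :
    HasMatDerivAt (fun t => F t - G t) (F' - G') x :=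
  fun i j => (hF i j).sub (hG i j)

theorem HasMatDerivAt.mul [Fintype m] {F : ℝ → Matrix l m ℂ} {G : ℝ → Matrix m n ℂ}
    {F' : Matrix l m ℂ} {G' : Matrix m n ℂ} {x : ℝ}
    (hF : HasMatDerivAt F F' x) (hG : HasMatDerivAt G G' x) :
    HasMatDerivAt (fun t => F t * G t) (F' * G x + F x * G') x := by
  intro i j
  simp only [Matrix.mul_apply, Matrix.add_apply, ← Finset.sum_add_distrib]
  exact HasDerivAt.fun_sum fun k _ => (hF i k).mul (hG k j)

theorem HasMatDerivAt.conjTranspose {F : ℝ → Matrix m n ℂ} {F' : Matrix m n ℂ} {x : ℝ}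
    (hF : HasMatDerivAt F F' x) : HasMatDerivAt (fun t => (F t)ᴴ) F'ᴴ x :=
  fun i j => (hF j i).star

theorem HasMatDerivAt.const_mul [Fintype m] (C : Matrix l m ℂ) {G : ℝ → Matrix m n ℂ}
    {G' : Matrix m n ℂ} {x : ℝ} (hG : HasMatDerivAt G G' x) :
    HasMatDerivAt (fun t => C * G t) (C * G') x := by
  simpa using (hasMatDerivAt_const C x).mul hG

theorem HasMatDerivAt.mul_const [Fintype m] {F : ℝ → Matrix l m ℂ} {F' : Matrix l m ℂ} {x : ℝ}
    (hF : HasMatDerivAt F F' x) (C : Matrix m n ℂ) :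
    HasMatDerivAt (fun t => F t * C) (F' * C) x := by
  simpa using hF.mul (hasMatDerivAt_const C x)

theorem HasMatDerivAt.congr_deriv {F : ℝ → Matrix m n ℂ} {F' G' : Matrix m n ℂ} {x : ℝ}
    (hF : HasMatDerivAt F F' x) (h : F' = G') : HasMatDerivAt F G' x := h ▸ hF

theorem HasMatDerivAt.unique {F : ℝ → Matrix m n ℂ} {F' G' : Matrix m n ℂ} {x : ℝ}
    (hF : HasMatDerivAt F F' x) (hG : HasMatDerivAt F G' x) : F' = G' := by
  ext i j
  exact (hF i j).unique (hG i j)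

theorem HasMatDerivAt.congr_of_eventuallyEq {F G : ℝ → Matrix m n ℂ} {F' : Matrix m n ℂ} {x : ℝ}
    (hF : HasMatDerivAt F F' x) (h : ∀ᶠ t in 𝓝 x, G t = F t) : HasMatDerivAt G F' x :=
  fun i j => (hF i j).congr_of_eventuallyEq (h.mono fun t ht => by simp only [ht])

theorem differentiableAt_det [Fintype n] [DecidableEq n] {F : ℝ → Matrix n n ℂ} {x : ℝ}
    (hF : ∀ i j, DifferentiableAt ℝ (fun t => F t i j) x) :
    DifferentiableAt ℝ (fun t => (F t).det) x := by
  simp only [Matrix.det_apply]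
  refine DifferentiableAt.fun_sum fun σ _ => DifferentiableAt.const_smul ?_ _
  exact (HasDerivAt.fun_finsetProd fun i _ => (hF (σ i) i).hasDerivAt).differentiableAt

theorem meromorphicAt_det [Fintype n] [DecidableEq n] {F : ℝ → Matrix n n ℂ}
    (hF : MatMeromorphic F) : MeromorphicAt (fun t => (F t).det) (0 : ℝ) := by
  simp only [Matrix.det_apply]
  refine MeromorphicAt.fun_sum fun σ _ => ?_
  have h := MeromorphicAt.fun_prod (s := Finset.univ) fun i (_ : i ∈ Finset.univ) => hF (σ i) i
  have := (MeromorphicAt.const ((Equiv.Perm.sign σ : ℤ) : ℂ) (0 : ℝ)).mul h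
  refine this.congr (Eventually.of_forall fun t => ?_)
  simp [Units.smul_def]

theorem differentiableAt_inv [Fintype n] [DecidableEq n] {F : ℝ → Matrix n n ℂ} {x : ℝ}
    (hF : ∀ i j, DifferentiableAt ℝ (fun t => F t i j) x) (hx : (F x).det ≠ 0) (i j : n) :
    DifferentiableAt ℝ (fun t => (F t)⁻¹ i j) x := by
  simp only [Matrix.inv_def, Ring.inverse_eq_inv', Matrix.smul_apply, smul_eq_mul,
    Matrix.adjugate_apply]
  refine ((differentiableAt_det hF).inv hx).mul (differentiableAt_det fun a b => ?_)
  by_cases h : a = j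
  · subst h; simp
  · simpa [Matrix.updateRow_ne h] using hF a b

/-- Adjugate over determinant. Nothing is assumed about the determinant: it may vanish at `0`, which
is precisely the case needed for `S`. -/
theorem MatMeromorphic.inv [Fintype n] [DecidableEq n] {F : ℝ → Matrix n n ℂ}
    (hF : MatMeromorphic F) : MatMeromorphic fun t => (F t)⁻¹ := by
  intro i j
  simp only [Matrix.inv_def, Ring.inverse_eq_inv', Matrix.smul_apply, smul_eq_mul,
    Matrix.adjugate_apply]
  refine (meromorphicAt_det hF).inv.mul (meromorphicAt_det fun a b => ?_)
  by_cases h : a = j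
  · subst h; simp
  · simpa [Matrix.updateRow_ne h] using hF a b

theorem MatMeromorphic.mul [Fintype m] {F : ℝ → Matrix l m ℂ} {G : ℝ → Matrix m n ℂ}
    (hF : MatMeromorphic F) (hG : MatMeromorphic G) : MatMeromorphic fun t => F t * G t := by
  intro i j
  simp only [Matrix.mul_apply]
  exact MeromorphicAt.fun_sum fun k _ => (hF i k).mul (hG k j)

theorem MatMeromorphic.sub {F G : ℝ → Matrix m n ℂ}
    (hF : MatMeromorphic F) (hG : MatMeromorphic G) : MatMeromorphic fun t => F t - G t :=
  fun i j => (hF i j).sub (hG i j)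

/-- Conjugation is real linear, hence harmless because meromorphy is taken in a real variable. -/
theorem MatMeromorphic.conjTranspose {F : ℝ → Matrix m n ℂ} (hF : MatMeromorphic F) :
    MatMeromorphic fun t => (F t)ᴴ := by
  intro i j
  obtain ⟨k, hk⟩ := hF j i
  refine ⟨k, ?_⟩
  have := (Complex.conjCLE.toContinuousLinearMap.analyticAt _).comp hk
  refine this.congr (Eventually.of_forall fun t => ?_)
  simp

/-- Derivative of the inverse of a matrix valued function. -/
theorem HasMatDerivAt.inv [Fintype n] [DecidableEq n] {F : ℝ → Matrix n n ℂ} {F' : Matrix n n ℂ}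
    {x : ℝ} (hF : HasMatDerivAt F F' x) (hx : (F x).det ≠ 0) :
    HasMatDerivAt (fun t => (F t)⁻¹) (-((F x)⁻¹ * F' * (F x)⁻¹)) x := by
  have hd : ∀ i j, DifferentiableAt ℝ (fun t => F t i j) x := fun i j => (hF i j).differentiableAt
  set D : Matrix n n ℂ := Matrix.of fun i j => deriv (fun t => (F t)⁻¹ i j) x
  have hD : HasMatDerivAt (fun t => (F t)⁻¹) D x :=
    fun i j => (differentiableAt_inv hd hx i j).hasDerivAt
  have hne : ∀ᶠ t in 𝓝 x, (1 : Matrix n n ℂ) = F t * (F t)⁻¹ := by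
    filter_upwards [(differentiableAt_det hd).continuousAt.eventually_ne hx] with t ht
    exact (Matrix.mul_nonsing_inv _ (isUnit_iff_ne_zero.2 ht)).symm
  -- Differentiability of the inverse is known from the adjugate formula; its value comes from
  -- differentiating `F F⁻¹ = 1` near `x`.
  have h0 := ((hF.mul hD).congr_of_eventuallyEq hne).unique (hasMatDerivAt_const 1 x)
  have hu := isUnit_iff_ne_zero.2 hx
  refine hD.congr_deriv ?_
  calc D = (F x)⁻¹ * (F' * (F x)⁻¹ + F x * D) - (F x)⁻¹ * F' * (F x)⁻¹ := by
        rw [mul_add, Matrix.nonsing_inv_mul_cancel_left _ _ hu]; simp [mul_assoc]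
    _ = _ := by rw [h0]; simp

end MatrixCalculus

/-! ### Nodes, the transfer function and its inverse -/

section Nodes

theorem Jb_mul_Jb : Jb * Jb = -1 := by
  ext i j; fin_cases i <;> fin_cases j <;> simp [Jb]

theorem Jb_conjTranspose : Jbᴴ = -Jb := by
  ext i j; fin_cases i <;> fin_cases j <;> simp [Jb]

variable {n : Type} [Fintype n] [DecidableEq n]

/-- A triple `A, P(x), S(x)` with `P' = -A P J`, `S' = P P*` and `A S - S A* = P J P*`, where
`S(x)` is positive definite for `x > 0` and `P`, `S` are analytic at `0`. -/
structure IsNode (A : Matrix n n ℂ) (P : ℝ → Matrix n (Fin 2) ℂ) (S : ℝ → Matrix n n ℂ) :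
    Prop where
  deriv_P : ∀ x, HasMatDerivAt P (-(A * P x * Jb)) x
  deriv_S : ∀ x, HasMatDerivAt S (P x * (P x)ᴴ) x
  identity : ∀ x, A * S x - S x * Aᴴ = P x * Jb * (P x)ᴴ
  posDef : ∀ x, 0 < x → (S x).PosDef
  analytic_P : ∀ i j, AnalyticAt ℝ (fun t => P t i j) 0
  analytic_S : ∀ i j, AnalyticAt ℝ (fun t => S t i j) 0

/-- The matrix function `P* S⁻¹ P`. -/
noncomputable def nodeX (P : ℝ → Matrix n (Fin 2) ℂ) (S : ℝ → Matrix n n ℂ) (x : ℝ) :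
    Matrix (Fin 2) (Fin 2) ℂ :=
  (P x)ᴴ * (S x)⁻¹ * P x

variable {A : Matrix n n ℂ} {P : ℝ → Matrix n (Fin 2) ℂ} {S : ℝ → Matrix n n ℂ} {x : ℝ}

theorem IsNode.isUnit_det (h : IsNode A P S) (hx : 0 < x) : IsUnit (S x).det :=
  isUnit_iff_ne_zero.2 (h.posDef x hx).det_pos.ne'

/-- The identity `A* S⁻¹ = S⁻¹ A - S⁻¹ P J P* S⁻¹`. -/
theorem IsNode.conjTranspose_mul_inv (h : IsNode A P S) (hx : 0 < x) :
    Aᴴ * (S x)⁻¹ = (S x)⁻¹ * A - (S x)⁻¹ * P x * Jb * ((P x)ᴴ * (S x)⁻¹) := by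
  have hu := h.isUnit_det hx
  have e := congrArg (fun M => (S x)⁻¹ * M * (S x)⁻¹) (h.identity x)
  simp only [mul_sub, sub_mul] at e
  rw [← Matrix.mul_assoc, ← Matrix.mul_assoc, Matrix.nonsing_inv_mul _ hu,
    Matrix.mul_nonsing_inv_cancel_right _ _ hu, Matrix.one_mul] at e
  simp only [Matrix.mul_assoc] at e ⊢
  rw [← e]; abel

/-- The derivative of `P*` brings in `A*`, which is moved through `S⁻¹` so that only `A`, on the far
right, remains; there it can meet the resolvent. -/
theorem IsNode.deriv_left (h : IsNode A P S) (hx : 0 < x) :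
    HasMatDerivAt (fun t => (P t)ᴴ * (S t)⁻¹)
      (Jb * ((P x)ᴴ * (S x)⁻¹) * A - Jb * nodeX P S x * Jb * ((P x)ᴴ * (S x)⁻¹)
        - nodeX P S x * ((P x)ᴴ * (S x)⁻¹)) x := by
  refine (((h.deriv_P x).conjTranspose).mul
    ((h.deriv_S x).inv (h.isUnit_det hx).ne_zero)).congr_deriv ?_
  have e := h.conjTranspose_mul_inv hx
  simp only [Matrix.conjTranspose_neg, Matrix.conjTranspose_mul, Jb_conjTranspose, nodeX,
    Matrix.mul_assoc, Matrix.neg_mul, Matrix.mul_neg, neg_neg, e, Matrix.mul_sub]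
  abel

/-- With `B` the resolvent, `A B = B A = 1 + z B`. The terms free of `B` supply the constant part of
`w`, and the rest regroups into `w` itself. -/
theorem IsNode.deriv_transfer (h : IsNode A P S) (hx : 0 < x) {z : ℂ} (B : Matrix n n ℂ)
    (hB : (A - z • 1) * B = 1) :
    let w := fun t => 1 - Jb * (P t)ᴴ * (S t)⁻¹ * B * P t
    HasMatDerivAt w (z • (Jb * w x - w x * Jb) - (Jb * nodeX P S x * Jbᴴ - nodeX P S x) * w x)
      x := by
  intro w
  have hBA : B * (A - z • 1) = 1 := mul_eq_one_comm.1 hB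
  have hAB : A * B = 1 + z • B := by
    rw [← hB, Matrix.sub_mul, Matrix.smul_mul, Matrix.one_mul, sub_add_cancel]
  have hBA : B * A = 1 + z • B := by
    rw [← hBA, Matrix.mul_sub, Matrix.mul_smul, Matrix.mul_one, sub_add_cancel]
  have hd := (hasMatDerivAt_const (1 : Matrix (Fin 2) (Fin 2) ℂ) x).sub
    ((((h.deriv_left hx).const_mul Jb).mul_const B).mul (h.deriv_P x))
  set M := (P x)ᴴ * (S x)⁻¹ with hM
  have hw : w x = 1 - Jb * (M * (B * P x)) := by simp [w, hM, Matrix.mul_assoc]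
  have hX : nodeX P S x = M * P x := rfl
  have hJ : ∀ {k : Type} (N : Matrix (Fin 2) k ℂ), Jb * (Jb * N) = -N := fun N => by
    rw [← Matrix.mul_assoc, Jb_mul_Jb, Matrix.neg_mul, Matrix.one_mul]
  have hAB' : ∀ {k : Type} (N : Matrix n k ℂ), A * (B * N) = N + z • (B * N) := fun N => by
    rw [← Matrix.mul_assoc, hAB, Matrix.add_mul, Matrix.one_mul, Matrix.smul_mul]
  have hBA' : ∀ {k : Type} (N : Matrix n k ℂ), B * (A * N) = N + z • (B * N) := fun N => by
    rw [← Matrix.mul_assoc, hBA, Matrix.add_mul, Matrix.one_mul, Matrix.smul_mul]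
  have hfun : w = fun t => (1 : Matrix (Fin 2) (Fin 2) ℂ) - Jb * ((P t)ᴴ * (S t)⁻¹) * B * P t := by
    funext t; simp only [w, Matrix.mul_assoc]
  rw [hfun] at hw ⊢
  refine hd.congr_deriv ?_
  simp only [hw, hX, Jb_conjTranspose]
  simp only [Matrix.mul_assoc, Matrix.mul_sub, Matrix.sub_mul, Matrix.mul_neg, Matrix.neg_mul,
    hJ, hAB', hBA', Matrix.mul_add, Matrix.mul_one, Matrix.one_mul, smul_sub,
    smul_neg, Matrix.mul_smul]
  abel

/-- The inverse is `1 + J P* C S⁻¹ P` with `C` the resolvent of `A*`. The quadratic term of the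
product cancels the linear ones, since `P J P* = (A - z) S - S (A* - z)`. -/
theorem IsNode.transfer_det_ne_zero (h : IsNode A P S) (hx : 0 < x) {z : ℂ} (B C : Matrix n n ℂ)
    (hB : (A - z • 1) * B = 1) (hC : (Aᴴ - z • 1) * C = 1) :
    (1 - Jb * (P x)ᴴ * (S x)⁻¹ * B * P x).det ≠ 0 := by
  have hu := h.isUnit_det hx
  have hBA : B * (A - z • 1) = 1 := mul_eq_one_comm.1 hB
  have key : (S x)⁻¹ * B * (P x * Jb * (P x)ᴴ) * C * (S x)⁻¹ = C * (S x)⁻¹ - (S x)⁻¹ * B := by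
    have e : P x * Jb * (P x)ᴴ = (A - z • 1) * S x - S x * (Aᴴ - z • 1) := by
      rw [← h.identity x]; simp [Matrix.sub_mul, Matrix.mul_sub]
    rw [e]
    calc (S x)⁻¹ * B * ((A - z • 1) * S x - S x * (Aᴴ - z • 1)) * C * (S x)⁻¹
        = (S x)⁻¹ * (B * (A - z • 1)) * S x * C * (S x)⁻¹
          - (S x)⁻¹ * B * S x * ((Aᴴ - z • 1) * C) * (S x)⁻¹ := by
          simp only [Matrix.mul_assoc, Matrix.mul_sub, Matrix.sub_mul]
      _ = _ := by
          rw [hBA, hC, Matrix.mul_one, Matrix.mul_one, Matrix.nonsing_inv_mul _ hu,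
            Matrix.mul_nonsing_inv_cancel_right _ _ hu, Matrix.one_mul]
  have hmul : (1 - Jb * (P x)ᴴ * (S x)⁻¹ * B * P x) * (1 + Jb * (P x)ᴴ * C * (S x)⁻¹ * P x) = 1 := by
    have : (1 - Jb * (P x)ᴴ * (S x)⁻¹ * B * P x) * (1 + Jb * (P x)ᴴ * C * (S x)⁻¹ * P x)
        = 1 + Jb * (P x)ᴴ * (C * (S x)⁻¹ - (S x)⁻¹ * B
          - (S x)⁻¹ * B * (P x * Jb * (P x)ᴴ) * C * (S x)⁻¹) * P x := by
      simp only [Matrix.mul_assoc, Matrix.mul_sub, Matrix.sub_mul, Matrix.mul_add, Matrix.mul_one,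
        Matrix.one_mul]
      abel
    rw [this, key]; simp
  intro h0
  have := congrArg Matrix.det hmul
  rw [Matrix.det_mul, h0] at this
  simp at this

end Nodes

/-! ### Scalar and row asymptotics at a regular singularity -/

section Asymptotics

/-- A finite limit excludes a pole of `x f(x)`, so this function agrees on the right of `0` with an
analytic `g`, `g 0 = L`. Then `f x - L / x` is the difference quotient of `g` at `0`, which
converges. -/
theorem MeromorphicAt.exists_bound_sub_div {f : ℝ → ℂ} (hf : MeromorphicAt f 0) {L : ℂ}
    (hL : Tendsto (fun x : ℝ => (x : ℂ) * f x) (𝓝[>] 0) (𝓝 L)) :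
    ∃ C : ℝ, ∀ᶠ x : ℝ in 𝓝[>] 0, ‖f x - L / (x : ℂ)‖ ≤ C := by
  have hle : 𝓝[>] (0 : ℝ) ≤ 𝓝[≠] 0 := nhdsWithin_mono _ fun x hx => ne_of_gt hx
  have hF : MeromorphicAt (fun x : ℝ => (x : ℂ) * f x) 0 :=
    (Complex.ofRealCLM.analyticAt 0).meromorphicAt.mul hf
  have ho : 0 ≤ meromorphicOrderAt (fun x : ℝ => (x : ℂ) * f x) 0 := by
    by_contra! h
    exact not_tendsto_nhds_of_tendsto_atTop (tendsto_norm_atTop_iff_cobounded.2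
      ((tendsto_cobounded_of_meromorphicOrderAt_neg h).mono_left hle)) _ hL.norm
  obtain ⟨g, hg, hfg⟩ := hF.meromorphicOrderAt_nonneg_iff.1 ho
  have hfg' : ∀ᶠ x : ℝ in 𝓝[>] 0, (x : ℂ) * f x = g x := hfg.filter_mono hle
  have hg0 : g 0 = L := tendsto_nhds_unique
    ((hg.continuousAt.tendsto.mono_left nhdsWithin_le_nhds).congr' (hfg'.mono fun _ h => h.symm)) hL
  have hs := (hg.differentiableAt.hasDerivAt.tendsto_slope.mono_left hle).norm
  refine ⟨‖deriv g 0‖ + 1, ?_⟩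
  filter_upwards [hs.eventually (gt_mem_nhds (lt_add_one _)), hfg',
    self_mem_nhdsWithin] with x hx hxg (hx0 : 0 < x)
  have hxc : (x : ℂ) ≠ 0 := by exact_mod_cast hx0.ne'
  have : slope g 0 x = f x - L / x := by
    rw [slope_def_module, ← hxg, hg0, sub_zero, Complex.real_smul]
    push_cast
    field_simp
  rw [← this]; exact hx.le

variable {p g : ℝ → Fin 2 → ℂ} {s : ℝ → ℝ}

theorem exists_eq_zpow_smul (hp : ∀ j, MeromorphicAt (fun x => p x j) 0)
    (h0 : ¬ ∀ᶠ x in 𝓝[>] (0 : ℝ), p x = 0) :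
    ∃ (n : ℤ) (g : ℝ → Fin 2 → ℂ), AnalyticAt ℝ g 0 ∧ g 0 ≠ 0 ∧
      ∀ᶠ x in 𝓝[>] (0 : ℝ), p x = x ^ n • g x := by
  have hle : 𝓝[>] (0 : ℝ) ≤ 𝓝[≠] 0 := nhdsWithin_mono _ fun x hx => ne_of_gt hx
  have hm : MeromorphicAt p 0 := by
    have := ((hp 0).smul (MeromorphicAt.const (Pi.single 0 1 : Fin 2 → ℂ) 0)).add
      ((hp 1).smul (MeromorphicAt.const (Pi.single 1 1 : Fin 2 → ℂ) 0))
    refine this.congr (Eventually.of_forall fun x => ?_)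
    ext j; fin_cases j <;> simp
  have ht : meromorphicOrderAt p 0 ≠ ⊤ := fun h =>
    h0 ((meromorphicOrderAt_eq_top_iff.1 h).filter_mono hle)
  obtain ⟨g, hg, hg0, he⟩ := (meromorphicOrderAt_ne_top_iff hm).1 ht
  exact ⟨_, g, hg, hg0, (he.filter_mono hle).mono fun x hx => by simpa using hx⟩

/-- Indicial equation: insert `p = xⁿ g` into `p' = p Q`, multiply by `x^{1-n}` and let `x → 0+`. -/
theorem leading_exponent {n : ℤ} (hg : AnalyticAt ℝ g 0)
    (hpg : ∀ᶠ x in 𝓝[>] (0 : ℝ), p x = x ^ n • g x) {p' : ℝ → Fin 2 → ℂ}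
    (hp' : ∀ j, ∀ᶠ x in 𝓝[>] (0 : ℝ), HasDerivAt (fun t => p t j) (p' x j) x)
    {Q : ℝ → Matrix (Fin 2) (Fin 2) ℂ}
    (hQ : ∀ᶠ x in 𝓝[>] (0 : ℝ), p' x = p x ᵥ* Q x) {R : Matrix (Fin 2) (Fin 2) ℂ}
    (hR : ∀ i j, Tendsto (fun x : ℝ => (x : ℂ) * Q x i j) (𝓝[>] 0) (𝓝 (R i j))) :
    (n : ℂ) • g 0 = g 0 ᵥ* R := by
  have hgt : ∀ j, Tendsto (fun x => g x j) (𝓝[>] 0) (𝓝 (g 0 j)) := fun j =>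
    (((continuous_apply j).continuousAt.comp hg.continuousAt).tendsto).mono_left nhdsWithin_le_nhds
  have hg't : ∀ j, Tendsto (fun x => deriv g x j) (𝓝[>] 0) (𝓝 (deriv g 0 j)) := fun j =>
    (((continuous_apply j).continuousAt.comp hg.deriv.continuousAt).tendsto).mono_left
      nhdsWithin_le_nhds
  have hx0 : Tendsto (fun x : ℝ => (x : ℂ)) (𝓝[>] 0) (𝓝 0) :=
    (Complex.continuous_ofReal.tendsto' 0 0 (by simp)).mono_left nhdsWithin_le_nhds
  have hga : ∀ᶠ x in 𝓝[>] (0 : ℝ), AnalyticAt ℝ g x :=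
    hg.eventually_analyticAt.filter_mono nhdsWithin_le_nhds
  ext j
  have key : ∀ᶠ x : ℝ in 𝓝[>] 0, (n : ℂ) * g x j + (x : ℂ) * deriv g x j
      = ∑ i, g x i * ((x : ℂ) * Q x i j) := by
    filter_upwards [eventually_eventually_nhdsWithin.2 hpg, hpg, hp' j, hQ, hga,
      self_mem_nhdsWithin] with x hpx hpx' hd hq ha (hx : 0 < x)
    -- At a point `x > 0` the factorization holds on a full neighbourhood, so it may be
    -- differentiated.
    rw [nhdsWithin_eq_nhds.2 (Ioi_mem_nhds hx)] at hpx
    have h1 : HasDerivAt (fun t => p t j)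
        (((n * x ^ (n - 1) : ℝ) : ℂ) * g x j + ((x ^ n : ℝ) : ℂ) * deriv g x j) x := by
      have h2 := ((hasDerivAt_zpow n x (Or.inl hx.ne')).ofReal_comp).mul
        (hasDerivAt_pi.1 ha.differentiableAt.hasDerivAt j)
      refine h2.congr_of_eventuallyEq (hpx.mono fun t ht => ?_)
      simp [ht]
    have h3 := h1.unique hd
    rw [hq, hpx', Matrix.smul_vecMul, zpow_sub_one₀ hx.ne'] at h3
    have hc : ((x ^ n : ℝ) : ℂ) ≠ 0 := by exact_mod_cast (zpow_pos hx n).ne'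
    have hxc : (x : ℂ) ≠ 0 := by exact_mod_cast hx.ne'
    have h4 : ((n : ℂ) * g x j + (x : ℂ) * deriv g x j) * ((x ^ n : ℝ) : ℂ)
        = (x : ℂ) * (g x ᵥ* Q x) j * ((x ^ n : ℝ) : ℂ) := by
      simp only [Pi.smul_apply, Complex.real_smul] at h3
      rw [mul_assoc, mul_comm ((g x ᵥ* Q x) j), ← h3]
      push_cast
      field_simp
    rw [mul_right_cancel₀ hc h4, Matrix.vecMul, dotProduct, Finset.mul_sum]
    exact Finset.sum_congr rfl fun i _ => by ring
  have hl : Tendsto (fun x : ℝ => (n : ℂ) * g x j + (x : ℂ) * deriv g x j) (𝓝[>] 0)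
      (𝓝 ((n : ℂ) * g 0 j + 0 * deriv g 0 j)) :=
    ((hgt j).const_mul _).add (hx0.mul (hg't j))
  have hr : Tendsto (fun x : ℝ => ∑ i, g x i * ((x : ℂ) * Q x i j)) (𝓝[>] 0)
      (𝓝 (∑ i, g 0 i * R i j)) :=
    tendsto_finsetSum _ fun i _ => (hgt i).mul (hR i j)
  have := tendsto_nhds_unique (hl.congr' key) hr
  simpa [Matrix.vecMul, dotProduct] using this

theorem sum_sq_norm_pos {v : Fin 2 → ℂ} (hv : v ≠ 0) : 0 < ∑ i, ‖v i‖ ^ 2 := by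
  obtain ⟨i, hi⟩ := Function.ne_iff.1 hv
  exact Finset.sum_pos' (fun _ _ => by positivity) ⟨i, Finset.mem_univ _, by
    have : v i ≠ 0 := hi
    positivity⟩

theorem tendsto_sum_sq_norm (hg : ContinuousAt g 0) :
    Tendsto (fun x => ∑ i, ‖g x i‖ ^ 2) (𝓝[>] (0 : ℝ)) (𝓝 (∑ i, ‖g 0 i‖ ^ 2)) :=
  tendsto_finsetSum _ fun i _ => ((((continuous_apply i).continuousAt.comp hg).tendsto).mono_left
    nhdsWithin_le_nhds).norm.pow 2

theorem sum_sq_norm_zpow_smul (n : ℤ) (x : ℝ) (v : Fin 2 → ℂ) :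
    ∑ i, ‖(x ^ n • v) i‖ ^ 2 = (x ^ n) ^ 2 * ∑ i, ‖v i‖ ^ 2 := by
  simp only [Pi.smul_apply, norm_smul, Real.norm_eq_abs, mul_pow, sq_abs, Finset.mul_sum]

/-- If `n ≤ -1`, then `s' ≥ d x⁻²` near `0` for some `d > 0`, so `s + d/x` is increasing and hence
bounded above near `0`; but `s > 0` and `d/x → ∞`. -/
theorem exponent_nonneg {n : ℤ} (hg : ContinuousAt g 0) (hg0 : g 0 ≠ 0)
    (hpg : ∀ᶠ x in 𝓝[>] (0 : ℝ), p x = x ^ n • g x) (hs : ∀ᶠ x in 𝓝[>] (0 : ℝ), 0 < s x)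
    (hs' : ∀ᶠ x in 𝓝[>] (0 : ℝ), HasDerivAt s (∑ i, ‖p x i‖ ^ 2) x) : 0 ≤ n := by
  by_contra! hn
  have hpos := sum_sq_norm_pos hg0
  set d := (∑ i, ‖g 0 i‖ ^ 2) / 2 with hd
  have hd0 : 0 < d := by positivity
  have hev : ∀ᶠ x in 𝓝[>] (0 : ℝ), d < ∑ i, ‖g x i‖ ^ 2 :=
    (tendsto_sum_sq_norm hg).eventually (lt_mem_nhds (by linarith))
  obtain ⟨ε, hε, hall⟩ := mem_nhdsGT_iff_exists_Ioo_subset.1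
    ((hpg.and (hs.and (hs'.and hev))).and (Ioo_mem_nhdsGT one_pos))
  have hder : ∀ x ∈ Set.Ioo 0 ε,
      HasDerivAt (fun t => s t + d * t⁻¹) (∑ i, ‖p x i‖ ^ 2 + d * (-(x ^ 2)⁻¹)) x := fun x hx =>
    (hall hx).1.2.2.1.add ((hasDerivAt_inv hx.1.ne').const_mul d)
  have hmono : MonotoneOn (fun t => s t + d * t⁻¹) (Set.Ioo 0 ε) := by
    refine monotoneOn_of_hasDerivWithinAt_nonneg (convex_Ioo 0 ε)
      (fun x hx => (hder x hx).continuousAt.continuousWithinAt)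
      (fun x hx => (hder x (interior_subset hx)).hasDerivWithinAt) fun x hx => ?_
    obtain ⟨⟨hp, -, -, hlt⟩, hx0, hx1⟩ := hall (interior_subset hx)
    rw [hp, sum_sq_norm_zpow_smul]
    have h1 : x⁻¹ ≤ x ^ n := by
      rw [← _root_.zpow_neg_one]
      exact zpow_le_zpow_right_of_le_one₀ hx0 hx1.le (by omega)
    have h2 : (x ^ 2)⁻¹ ≤ (x ^ n) ^ 2 := by
      rw [← inv_pow]
      exact pow_le_pow_left₀ (by positivity) h1 2
    nlinarith [mul_le_mul h2 hlt.le hd0.le (by positivity)]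
  have hε' : (0 : ℝ) < ε := hε
  set K := s (ε / 2) + d * (ε / 2)⁻¹ with hK
  have hmem : ε / 2 ∈ Set.Ioo 0 ε := ⟨by linarith, by linarith⟩
  have hK0 : 0 < K := add_pos (hall hmem).1.2.1 (by positivity)
  -- Small enough that `d / y ≥ K + 1`, whereas monotonicity bounds `s y + d / y` by `K`.
  set y := min (ε / 2) (d / (K + 1)) with hy
  have hy0 : 0 < y := lt_min (by linarith) (by positivity)
  have hymem : y ∈ Set.Ioo 0 ε := ⟨hy0, (min_le_left _ _).trans_lt hmem.2⟩
  have h1 : s y + d * y⁻¹ ≤ K := hmono hymem hmem (min_le_left _ _)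
  have h2 : K + 1 ≤ d * y⁻¹ := by
    rw [← div_eq_mul_inv, le_div_iff₀ hy0, mul_comm, ← le_div_iff₀ (by positivity)]
    exact min_le_right _ _
  linarith [(hall hymem).1.2.1]

/-- L'Hôpital: the quotient of derivatives is `|g x|² / (2n+1)`. -/
theorem tendsto_div_pow {n : ℕ} (hg : ContinuousAt g 0)
    (hpg : ∀ᶠ x in 𝓝[>] (0 : ℝ), p x = x ^ (n : ℤ) • g x)
    (hs' : ∀ᶠ x in 𝓝[>] (0 : ℝ), HasDerivAt s (∑ i, ‖p x i‖ ^ 2) x)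
    (hs0 : Tendsto s (𝓝[>] 0) (𝓝 0)) :
    Tendsto (fun x => s x / x ^ (2 * n + 1)) (𝓝[>] 0)
      (𝓝 ((∑ i, ‖g 0 i‖ ^ 2) / (2 * n + 1))) := by
  refine HasDerivAt.lhopital_zero_nhdsGT (f' := fun x => ∑ i, ‖p x i‖ ^ 2)
    (g' := fun x => ((2 * n + 1 : ℕ) : ℝ) * x ^ (2 * n)) hs'
    (Eventually.of_forall fun x => by simpa using hasDerivAt_pow (2 * n + 1) x) ?_ hs0
    ((Continuous.tendsto' (by fun_prop) _ _ (by simp)).mono_left nhdsWithin_le_nhds) ?_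
  · filter_upwards [self_mem_nhdsWithin] with x (hx : 0 < x)
    positivity
  · refine ((tendsto_sum_sq_norm hg).div_const _).congr' ?_
    filter_upwards [self_mem_nhdsWithin, hpg] with x (hx : 0 < x) hp
    rw [hp, sum_sq_norm_zpow_smul, zpow_natCast, ← pow_mul, mul_comm n 2]
    push_cast
    field_simp

/-- The powers balance: `x · x^{2n} / x^{2n+1} = 1`. The limit is `2n+1` times the orthogonal
projection determined by `g 0`. -/
theorem tendsto_rank_one {n : ℕ} (hg : ContinuousAt g 0) (hg0 : g 0 ≠ 0)
    (hpg : ∀ᶠ x in 𝓝[>] (0 : ℝ), p x = x ^ (n : ℤ) • g x)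
    (hs' : ∀ᶠ x in 𝓝[>] (0 : ℝ), HasDerivAt s (∑ i, ‖p x i‖ ^ 2) x)
    (hs0 : Tendsto s (𝓝[>] 0) (𝓝 0)) (i j : Fin 2) :
    Tendsto (fun x : ℝ => (x : ℂ) * (star (p x i) * (s x : ℂ)⁻¹ * p x j)) (𝓝[>] 0)
      (𝓝 ((2 * n + 1) * (star (g 0 i) * g 0 j) / ((∑ i, ‖g 0 i‖ ^ 2 : ℝ) : ℂ))) := by
  have hgt : ∀ j, Tendsto (fun x => g x j) (𝓝[>] 0) (𝓝 (g 0 j)) := fun j =>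
    (((continuous_apply j).continuousAt.comp hg).tendsto).mono_left nhdsWithin_le_nhds
  have hpos := sum_sq_norm_pos hg0
  have h1 := (Complex.continuous_ofReal.tendsto _).comp (tendsto_div_pow hg hpg hs' hs0)
  have h2 := ((hgt i).star.mul (hgt j)).div h1 (by
    have : (∑ i, ‖g 0 i‖ ^ 2) / (2 * (n : ℝ) + 1) ≠ 0 := by positivity
    exact_mod_cast this)
  have he : star (g 0 i) * g 0 j / (((∑ i, ‖g 0 i‖ ^ 2) / (2 * (n : ℝ) + 1) : ℝ) : ℂ)
      = (2 * n + 1) * (star (g 0 i) * g 0 j) / ((∑ i, ‖g 0 i‖ ^ 2 : ℝ) : ℂ) := by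
    rw [Complex.ofReal_div, div_div_eq_mul_div]
    push_cast
    ring
  rw [he] at h2
  refine h2.congr' ?_
  filter_upwards [hpg, self_mem_nhdsWithin] with x hp (hx : 0 < x)
  have hxc : (x : ℂ) ≠ 0 := by exact_mod_cast hx.ne'
  simp only [Pi.div_apply, Function.comp_apply, hp, Pi.smul_apply, Complex.real_smul, zpow_natCast,
    star_mul', Complex.ofReal_div, Complex.ofReal_pow, Complex.star_def, map_pow, Complex.conj_ofReal]
  rw [div_div_eq_mul_div, div_eq_mul_inv]
  ring

end Asymptotics

/-! ### Elimination of one row by the Schur complement -/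

section Schur

variable {n : Type} {P : ℝ → Matrix (n ⊕ Unit) (Fin 2) ℂ}
  {S : ℝ → Matrix (n ⊕ Unit) (n ⊕ Unit) ℂ}

variable [Fintype n] [DecidableEq n]

/-- The last row of `P` after elimination of the leading block of `S`. -/
noncomputable def schurRow (P : ℝ → Matrix (n ⊕ Unit) (Fin 2) ℂ)
    (S : ℝ → Matrix (n ⊕ Unit) (n ⊕ Unit) ℂ) (x : ℝ) : Matrix Unit (Fin 2) ℂ :=
  (P x).toRows₂ - (S x).toBlocks₂₁ * (S x).toBlocks₁₁⁻¹ * (P x).toRows₁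

/-- The Schur complement of the leading block of `S`. -/
noncomputable def schurPivot (S : ℝ → Matrix (n ⊕ Unit) (n ⊕ Unit) ℂ) (x : ℝ) :
    Matrix Unit Unit ℂ :=
  (S x).toBlocks₂₂ - (S x).toBlocks₂₁ * (S x).toBlocks₁₁⁻¹ * (S x).toBlocks₂₁ᴴ

variable {A₁ : Matrix n n ℂ} {r : Matrix Unit n ℂ} {a : Matrix Unit Unit ℂ} {x : ℝ}

omit [DecidableEq n] in
-- The zero upper right block keeps the eliminated row out of the leading equations.
theorem IsNode.leading (h : IsNode (fromBlocks A₁ 0 r a) P S) :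
    IsNode A₁ (fun x => (P x).toRows₁) (fun x => (S x).toBlocks₁₁) where
  deriv_P x i j := by
    refine HasDerivAt.congr_deriv (h.deriv_P x (Sum.inl i) j) ?_
    simp [Matrix.mul_apply, Fintype.sum_sum_type, toRows₁]
  deriv_S x i j := h.deriv_S x (Sum.inl i) (Sum.inl j)
  identity x := by
    ext i j
    have := congrFun (congrFun (h.identity x) (Sum.inl i)) (Sum.inl j)
    simpa [Matrix.mul_apply, Fintype.sum_sum_type, toRows₁, toBlocks₁₁] using this
  posDef x hx := (h.posDef x hx).submatrix Sum.inl_injective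
  analytic_P i j := h.analytic_P _ j
  analytic_S i j := h.analytic_S _ _

/-- Lower left block of the node identity times the inverse of the leading block of `S`. It removes
`r` from the derivative of the reduced row, leaving an equation in that row alone. -/
theorem IsNode.lower_eq (h : IsNode (fromBlocks A₁ 0 r a) P S) (hx : 0 < x) :
    r = schurRow P S x * Jb * ((P x).toRows₁ᴴ * (S x).toBlocks₁₁⁻¹)
      - a * ((S x).toBlocks₂₁ * (S x).toBlocks₁₁⁻¹)
      + (S x).toBlocks₂₁ * (S x).toBlocks₁₁⁻¹ * A₁ := by
  have hid : r * (S x).toBlocks₁₁ + a * (S x).toBlocks₂₁ - (S x).toBlocks₂₁ * A₁ᴴ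
      = (P x).toRows₂ * Jb * (P x).toRows₁ᴴ := by
    ext i j
    have := congrFun (congrFun (h.identity x) (Sum.inr i)) (Sum.inl j)
    simpa [Matrix.mul_apply, Fintype.sum_sum_type, toRows₁, toRows₂, toBlocks₁₁, toBlocks₂₁]
      using this
  have e := congrArg (· * (S x).toBlocks₁₁⁻¹) hid
  have hu : IsUnit (S x).toBlocks₁₁.det := h.leading.isUnit_det hx
  have hc : A₁ᴴ * (S x).toBlocks₁₁⁻¹ = _ := h.leading.conjTranspose_mul_inv hx
  simp only [Matrix.sub_mul, Matrix.add_mul, Matrix.mul_nonsing_inv_cancel_right _ _ hu,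
    Matrix.mul_assoc, hc, Matrix.mul_sub] at e
  simp only [schurRow, Matrix.sub_mul, Matrix.mul_assoc]
  rw [← e]
  abel

theorem IsNode.deriv_schurRow (h : IsNode (fromBlocks A₁ 0 r a) P S) (hx : 0 < x) :
    HasMatDerivAt (schurRow P S) (-(a * schurRow P S x * Jb) + schurRow P S x *
      (Jb * nodeX (fun x => (P x).toRows₁) (fun x => (S x).toBlocks₁₁) x * Jbᴴ
        - nodeX (fun x => (P x).toRows₁) (fun x => (S x).toBlocks₁₁) x)) x := by
  have hp : HasMatDerivAt (fun t => (P t).toRows₂)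
      (-((r * (P x).toRows₁ + a * (P x).toRows₂) * Jb)) x := by
    intro i j
    refine HasDerivAt.congr_deriv (h.deriv_P x (Sum.inr i) j) ?_
    simp [Matrix.mul_apply, Fintype.sum_sum_type, toRows₁, toRows₂]
  have hs : HasMatDerivAt (fun t => (S t).toBlocks₂₁) ((P x).toRows₂ * (P x).toRows₁ᴴ) x :=
    fun i j => h.deriv_S x (Sum.inr i) (Sum.inl j)
  have hu : IsUnit (S x).toBlocks₁₁.det := h.leading.isUnit_det hx
  refine (hp.sub ((hs.mul ((h.leading.deriv_S x).inv hu.ne_zero)).mul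
    (h.leading.deriv_P x))).congr_deriv ?_
  have hr := h.lower_eq hx
  set y := (S x).toBlocks₂₁ * (S x).toBlocks₁₁⁻¹ with hy
  set M := (P x).toRows₁ᴴ * (S x).toBlocks₁₁⁻¹ with hM
  have hX : nodeX (fun x => (P x).toRows₁) (fun x => (S x).toBlocks₁₁) x = M * (P x).toRows₁ := rfl
  have hrow : (P x).toRows₂ = schurRow P S x + y * (P x).toRows₁ := by simp [schurRow, hy]
  have hder : (P x).toRows₂ * (P x).toRows₁ᴴ * (S x).toBlocks₁₁⁻¹ + (S x).toBlocks₂₁ *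
      -((S x).toBlocks₁₁⁻¹ * ((P x).toRows₁ * (P x).toRows₁ᴴ) * (S x).toBlocks₁₁⁻¹)
      = schurRow P S x * M := by
    simp only [schurRow, hM, Matrix.sub_mul, Matrix.mul_neg, Matrix.mul_assoc]
    abel
  rw [hder, hr, hX, hrow, Jb_conjTranspose]
  simp only [Matrix.mul_add, Matrix.mul_sub, Matrix.add_mul, Matrix.sub_mul, Matrix.mul_neg,
    Matrix.mul_assoc]
  abel

omit [DecidableEq n] in
theorem IsNode.toBlocks₁₂_eq (h : IsNode (fromBlocks A₁ 0 r a) P S) (hx : 0 < x) :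
    (S x).toBlocks₁₂ = (S x).toBlocks₂₁ᴴ := by
  ext i j
  exact ((h.posDef x hx).isHermitian.apply (Sum.inl i) (Sum.inr j)).symm

theorem IsNode.inv_toBlocks₁₁_conjTranspose (h : IsNode (fromBlocks A₁ 0 r a) P S) (hx : 0 < x) :
    (S x).toBlocks₁₁⁻¹ᴴ = (S x).toBlocks₁₁⁻¹ := by
  rw [Matrix.conjTranspose_nonsing_inv, (h.leading.posDef x hx).isHermitian.eq]

/-- The four terms of the product rule complete to a square. -/
theorem IsNode.deriv_schurPivot (h : IsNode (fromBlocks A₁ 0 r a) P S) (hx : 0 < x) :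
    HasMatDerivAt (schurPivot S) (schurRow P S x * (schurRow P S x)ᴴ) x := by
  have hs : HasMatDerivAt (fun t => (S t).toBlocks₂₁) ((P x).toRows₂ * (P x).toRows₁ᴴ) x :=
    fun i j => h.deriv_S x (Sum.inr i) (Sum.inl j)
  have hd : HasMatDerivAt (fun t => (S t).toBlocks₂₂) ((P x).toRows₂ * (P x).toRows₂ᴴ) x :=
    fun i j => h.deriv_S x (Sum.inr i) (Sum.inr j)
  have hu : IsUnit (S x).toBlocks₁₁.det := h.leading.isUnit_det hx
  refine (hd.sub ((hs.mul ((h.leading.deriv_S x).inv hu.ne_zero)).mul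
    hs.conjTranspose)).congr_deriv ?_
  simp only [schurRow, Matrix.conjTranspose_sub, Matrix.conjTranspose_mul, Matrix.mul_assoc,
    h.inv_toBlocks₁₁_conjTranspose hx, Matrix.mul_sub, Matrix.sub_mul, Matrix.add_mul,
    Matrix.conjTranspose_conjTranspose, Matrix.mul_neg, Matrix.neg_mul]
  abel

theorem IsNode.isUnit_det_schurPivot (h : IsNode (fromBlocks A₁ 0 r a) P S) (hx : 0 < x) :
    IsUnit (schurPivot S x).det := by
  have hu : IsUnit (S x).toBlocks₁₁.det := h.leading.isUnit_det hx
  let _ := Matrix.invertibleOfIsUnitDet _ hu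
  have h1 := h.isUnit_det hx
  rw [← fromBlocks_toBlocks (S x), det_fromBlocks₁₁, h.toBlocks₁₂_eq hx,
    Matrix.invOf_eq_nonsing_inv] at h1
  exact isUnit_of_mul_isUnit_right h1

theorem IsNode.nodeX_eq (h : IsNode (fromBlocks A₁ 0 r a) P S) (hx : 0 < x) :
    nodeX P S x = nodeX (fun x => (P x).toRows₁) (fun x => (S x).toBlocks₁₁) x
      + (schurRow P S x)ᴴ * (schurPivot S x)⁻¹ * schurRow P S x := by
  have hu : IsUnit (S x).toBlocks₁₁.det := h.leading.isUnit_det hx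
  have hv := h.isUnit_det_schurPivot hx
  set p := schurRow P S x with hp
  set c := schurPivot S x with hc
  -- The solution of `S Z = P` found by block elimination, so that `X = P* Z` without inverting `S`
  -- blockwise.
  set Z := fromRows ((S x).toBlocks₁₁⁻¹ * ((P x).toRows₁ - (S x).toBlocks₂₁ᴴ * (c⁻¹ * p)))
    (c⁻¹ * p) with hZ
  have hSZ : S x * Z = P x := by
    conv_lhs => rw [← fromBlocks_toBlocks (S x), h.toBlocks₁₂_eq hx, hZ]
    conv_rhs => rw [← fromRows_toRows (P x)]
    rw [fromBlocks_mul_fromRows]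
    congr 1
    · rw [Matrix.mul_nonsing_inv_cancel_left _ _ hu]; abel
    · have h1 : (S x).toBlocks₂₂ = c + (S x).toBlocks₂₁ * (S x).toBlocks₁₁⁻¹ * (S x).toBlocks₂₁ᴴ := by
        simp [hc, schurPivot]
      rw [h1, Matrix.add_mul, Matrix.mul_nonsing_inv_cancel_left _ _ hv]
      simp only [hp, schurRow, Matrix.mul_assoc, Matrix.mul_sub]
      abel
  have hXZ : nodeX P S x = (P x)ᴴ * Z := by
    rw [nodeX, Matrix.mul_assoc]
    congr 1
    conv_lhs => rw [← hSZ]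
    exact Matrix.nonsing_inv_mul_cancel_left _ _ (h.isUnit_det hx)
  have hPZ : (P x)ᴴ * Z = (P x).toRows₁ᴴ * ((S x).toBlocks₁₁⁻¹ *
      ((P x).toRows₁ - (S x).toBlocks₂₁ᴴ * (c⁻¹ * p))) + (P x).toRows₂ᴴ * (c⁻¹ * p) := by
    conv_lhs => rw [← fromRows_toRows (P x), conjTranspose_fromRows_eq_fromCols_conjTranspose, hZ,
      fromCols_mul_fromRows]
  rw [hXZ, hPZ, nodeX]
  conv_rhs => rw [hp, schurRow]
  simp only [Matrix.conjTranspose_sub, Matrix.conjTranspose_mul, Matrix.mul_assoc,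
    h.inv_toBlocks₁₁_conjTranspose hx, Matrix.mul_sub, Matrix.sub_mul]
  rw [← Matrix.mul_sub, ← Matrix.mul_sub]
  simp only [hp, schurRow, Matrix.mul_assoc, Matrix.mul_sub]
  abel

end Schur

/-! ### Residues at the origin from the right -/

section Residues

/-- `R` is the limit of `x F(x)` as `x → 0+`. -/
def HasResidue {m n : Type*} (F : ℝ → Matrix m n ℂ) (R : Matrix m n ℂ) : Prop :=
  ∀ i j, Tendsto (fun x : ℝ => (x : ℂ) * F x i j) (𝓝[>] 0) (𝓝 (R i j))

variable {l m n : Type*}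

theorem HasResidue.add {F G : ℝ → Matrix m n ℂ} {R T : Matrix m n ℂ} (hF : HasResidue F R)
    (hG : HasResidue G T) : HasResidue (fun x => F x + G x) (R + T) := fun i j => by
  simpa [mul_add] using (hF i j).add (hG i j)

theorem HasResidue.sub {F G : ℝ → Matrix m n ℂ} {R T : Matrix m n ℂ} (hF : HasResidue F R)
    (hG : HasResidue G T) : HasResidue (fun x => F x - G x) (R - T) := fun i j => by
  simpa [mul_sub] using (hF i j).sub (hG i j)

theorem HasResidue.const_mul [Fintype m] {F : ℝ → Matrix m n ℂ} {R : Matrix m n ℂ}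
    (hF : HasResidue F R) (C : Matrix l m ℂ) : HasResidue (fun x => C * F x) (C * R) :=
  fun i j => by
    simp only [Matrix.mul_apply, Finset.mul_sum, mul_left_comm _ (C _ _)]
    exact tendsto_finsetSum _ fun k _ => (hF k j).const_mul _

theorem HasResidue.mul_const [Fintype m] {F : ℝ → Matrix l m ℂ} {R : Matrix l m ℂ}
    (hF : HasResidue F R) (C : Matrix m n ℂ) : HasResidue (fun x => F x * C) (R * C) :=
  fun i j => by
    simp only [Matrix.mul_apply, Finset.mul_sum, ← mul_assoc]
    exact tendsto_finsetSum _ fun k _ => (hF i k).mul_const _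

theorem HasResidue.congr' {F G : ℝ → Matrix m n ℂ} {R : Matrix m n ℂ} (hF : HasResidue F R)
    (h : ∀ x, 0 < x → F x = G x) : HasResidue G R := fun i j =>
  (hF i j).congr' (by
    filter_upwards [self_mem_nhdsWithin] with x hx
    rw [h x hx])

theorem tendsto_ofReal_nhdsGT_zero : Tendsto (fun x : ℝ => (x : ℂ)) (𝓝[>] 0) (𝓝 0) :=
  (Complex.continuous_ofReal.tendsto' 0 0 (by simp)).mono_left nhdsWithin_le_nhds

theorem HasMatDerivAt.hasResidue_zero {F : ℝ → Matrix m n ℂ} {F' : Matrix m n ℂ}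
    (h : HasMatDerivAt F F' 0) : HasResidue F 0 := fun i j => by
  simpa using tendsto_ofReal_nhdsGT_zero.mul
    ((h i j).continuousAt.tendsto.mono_left nhdsWithin_le_nhds)

end Residues

/-! ### Change of the residue caused by one row -/

section Step

theorem Jb_mul_mul_sub (X : Matrix (Fin 2) (Fin 2) ℂ) :
    Jb * X * Jbᴴ - X = !![X 1 1 - X 0 0, -X 1 0 - X 0 1; -X 0 1 - X 1 0, X 0 0 - X 1 1] := by
  ext i j
  fin_cases i <;> fin_cases j <;>
    simp [Jb, Matrix.mul_apply, Fin.sum_univ_two, Matrix.vecMul, dotProduct, Matrix.vecHead,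
      Matrix.vecTail]

/-- The potential `J X J* - X` with `X = P* S⁻¹ P`. -/
noncomputable def nodeQ {n : Type} [Fintype n] [DecidableEq n] (P : ℝ → Matrix n (Fin 2) ℂ)
    (S : ℝ → Matrix n n ℂ) (x : ℝ) : Matrix (Fin 2) (Fin 2) ℂ :=
  Jb * nodeX P S x * Jbᴴ - nodeX P S x

variable {n : Type} [Fintype n] [DecidableEq n]

omit [DecidableEq n] in
theorem IsNode.meromorphic_P {A : Matrix n n ℂ} {P : ℝ → Matrix n (Fin 2) ℂ}
    {S : ℝ → Matrix n n ℂ} (h : IsNode A P S) : MatMeromorphic P :=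
  fun i j => (h.analytic_P i j).meromorphicAt

omit [DecidableEq n] in
theorem IsNode.meromorphic_S {A : Matrix n n ℂ} {P : ℝ → Matrix n (Fin 2) ℂ}
    {S : ℝ → Matrix n n ℂ} (h : IsNode A P S) : MatMeromorphic S :=
  fun i j => (h.analytic_S i j).meromorphicAt

theorem IsNode.meromorphic_nodeX {A : Matrix n n ℂ} {P : ℝ → Matrix n (Fin 2) ℂ}
    {S : ℝ → Matrix n n ℂ} (h : IsNode A P S) : MatMeromorphic (nodeX P S) :=
  (h.meromorphic_P.conjTranspose.mul h.meromorphic_S.inv).mul h.meromorphic_P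

/-- Without singularity at `0` the potential has zero residue. -/
theorem IsNode.hasResidue_zero {A : Matrix n n ℂ} {P : ℝ → Matrix n (Fin 2) ℂ}
    {S : ℝ → Matrix n n ℂ} (h : IsNode A P S) (h0 : (S 0).det ≠ 0) : HasResidue (nodeQ P S) 0 := by
  have hX := ((h.deriv_P 0).conjTranspose.mul ((h.deriv_S 0).inv h0)).mul (h.deriv_P 0)
  exact (((hX.const_mul Jb).mul_const Jbᴴ).sub hX).hasResidue_zero

variable {P : ℝ → Matrix (n ⊕ Unit) (Fin 2) ℂ}
  {S : ℝ → Matrix (n ⊕ Unit) (n ⊕ Unit) ℂ}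
  {A₁ : Matrix n n ℂ} {r : Matrix Unit n ℂ} {a : Matrix Unit Unit ℂ} {x : ℝ}

theorem IsNode.schurPivot_pos (h : IsNode (fromBlocks A₁ 0 r a) P S) (hx : 0 < x) :
    0 < schurPivot S x () () := by
  have h1 : 0 < (S x).toBlocks₁₁.det := (h.leading.posDef x hx).det_pos
  have h2 := (h.posDef x hx).det_pos
  let _ := Matrix.invertibleOfIsUnitDet _ (isUnit_iff_ne_zero.2 h1.ne')
  rw [← fromBlocks_toBlocks (S x), det_fromBlocks₁₁, h.toBlocks₁₂_eq hx,
    Matrix.invOf_eq_nonsing_inv, Matrix.det_unique (n := Unit)] at h2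
  change 0 < (S x).toBlocks₁₁.det * schurPivot S x () () at h2
  rw [Complex.pos_iff] at h1 h2 ⊢
  simp only [Complex.mul_re, Complex.mul_im, ← h1.2, zero_mul, sub_zero, add_zero] at h2
  exact ⟨(mul_pos_iff_of_pos_left h1.1).1 h2.1,
    ((mul_eq_zero.1 h2.2.symm).resolve_left h1.1.ne').symm⟩

theorem IsNode.schurPivot_eq_re (h : IsNode (fromBlocks A₁ 0 r a) P S) (hx : 0 < x) :
    (((schurPivot S x () ()).re : ℝ) : ℂ) = schurPivot S x () () :=
  Complex.ext rfl (Complex.pos_iff.1 (h.schurPivot_pos hx)).2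

theorem IsNode.deriv_schurPivot_re (h : IsNode (fromBlocks A₁ 0 r a) P S) (hx : 0 < x) :
    HasDerivAt (fun t => (schurPivot S t () ()).re) (∑ i, ‖schurRow P S x () i‖ ^ 2) x := by
  have := (Complex.reCLM.hasFDerivAt.comp_hasDerivAt x (h.deriv_schurPivot hx () ()))
  refine this.congr_deriv ?_
  simp [Matrix.mul_apply, Complex.mul_conj, ← Complex.ofReal_pow, Complex.normSq_eq_norm_sq]

/-- Squeeze: the pivot is positive and is at most the corner entry of `S`, because a positive
semidefinite term is subtracted; the corner entry tends to `0`. -/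
theorem IsNode.tendsto_schurPivot (h : IsNode (fromBlocks A₁ 0 r a) P S)
    (h0 : S 0 (Sum.inr ()) (Sum.inr ()) = 0) :
    Tendsto (fun t => (schurPivot S t () ()).re) (𝓝[>] 0) (𝓝 0) := by
  have hc : Tendsto (fun t => (S t (Sum.inr ()) (Sum.inr ())).re) (𝓝[>] 0) (𝓝 0) := by
    have := (h.deriv_S 0 (Sum.inr ()) (Sum.inr ())).continuousAt.tendsto
    rw [h0] at this
    exact ((Complex.continuous_re.tendsto' 0 0 rfl).comp this).mono_left nhdsWithin_le_nhds
  refine tendsto_of_tendsto_of_tendsto_of_le_of_le' tendsto_const_nhds hc ?_ ?_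
  · filter_upwards [self_mem_nhdsWithin] with x hx
    exact (Complex.pos_iff.1 (h.schurPivot_pos hx)).1.le
  · filter_upwards [self_mem_nhdsWithin] with x hx
    have hp := ((h.leading.posDef x hx).inv.posSemidef.mul_mul_conjTranspose_same
      (S x).toBlocks₂₁).diag_nonneg (i := ())
    have := (Complex.nonneg_iff.1 hp).1
    simp only [schurPivot, Matrix.sub_apply, Complex.sub_re, toBlocks₂₂, Matrix.of_apply]
    linarith

theorem IsNode.meromorphic_schurRow (h : IsNode (fromBlocks A₁ 0 r a) P S) :
    MatMeromorphic (schurRow P S) :=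
  MatMeromorphic.sub (fun i j => h.meromorphic_P (Sum.inr i) j)
    (MatMeromorphic.mul (MatMeromorphic.mul (fun i j => h.meromorphic_S (Sum.inr i) (Sum.inl j))
      h.leading.meromorphic_S.inv) h.leading.meromorphic_P)

theorem IsNode.nodeQ_eq (h : IsNode (fromBlocks A₁ 0 r a) P S) (hx : 0 < x) :
    nodeQ P S x = nodeQ (fun x => (P x).toRows₁) (fun x => (S x).toBlocks₁₁) x +
      (Jb * ((schurRow P S x)ᴴ * (schurPivot S x)⁻¹ * schurRow P S x) * Jbᴴ
        - (schurRow P S x)ᴴ * (schurPivot S x)⁻¹ * schurRow P S x) := by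
  simp only [nodeQ, h.nodeX_eq hx, Matrix.mul_add, Matrix.add_mul]
  abel

/-- Shape of the eliminated row near a singularity with residue `κ σ₃`, and the residue after
the elimination step. -/
theorem IsNode.schur_step (h : IsNode (fromBlocks A₁ 0 r a) P S)
    (h0 : S 0 (Sum.inr ()) (Sum.inr ()) = 0) {κ : ℤ}
    (hres : HasResidue (nodeQ (fun x => (P x).toRows₁) (fun x => (S x).toBlocks₁₁))
      ((κ : ℂ) • sigma3)) :
    ∃ (k : ℕ) (g : ℝ → Fin 2 → ℂ), ContinuousAt g 0 ∧ g 0 ≠ 0 ∧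
      (∀ᶠ x in 𝓝[>] (0 : ℝ), schurRow P S x () = x ^ (k : ℤ) • g x) ∧
      (k : ℂ) * g 0 0 = κ * g 0 0 ∧ (k : ℂ) * g 0 1 = -κ * g 0 1 ∧
      (g 0 1 = 0 → HasResidue (nodeQ P S) (((κ - (2 * k + 1) : ℤ) : ℂ) • sigma3)) ∧
      (g 0 0 = 0 → HasResidue (nodeQ P S) (((κ + (2 * k + 1) : ℤ) : ℂ) • sigma3)) := by
  have hpos : ∀ᶠ x in 𝓝[>] (0 : ℝ), 0 < (schurPivot S x () ()).re := by
    filter_upwards [self_mem_nhdsWithin] with x hx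
    exact (Complex.pos_iff.1 (h.schurPivot_pos hx)).1
  have hder : ∀ᶠ x in 𝓝[>] (0 : ℝ), HasDerivAt (fun t => (schurPivot S t () ()).re)
      (∑ i, ‖schurRow P S x () i‖ ^ 2) x := by
    filter_upwards [self_mem_nhdsWithin] with x hx using h.deriv_schurPivot_re hx
  have hlim := h.tendsto_schurPivot h0
  -- A row vanishing near `0` would make the pivot constant there; a positive constant contradicts
  -- the limit `0`.
  have hne : ¬ ∀ᶠ x in 𝓝[>] (0 : ℝ), schurRow P S x () = 0 := by
    intro hz
    obtain ⟨ε, hε, hall⟩ := mem_nhdsGT_iff_exists_Ioo_subset.1 (hz.and (hpos.and hder))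
    have hε' : (0 : ℝ) < ε := hε
    have hconst : ∀ x ∈ Set.Ioo 0 ε, (schurPivot S x () ()).re = (schurPivot S (ε / 2) () ()).re := by
      intro x hx
      refine (isOpen_Ioo.is_const_of_deriv_eq_zero (convex_Ioo 0 ε).isPreconnected
        (fun y hy => (hall hy).2.2.differentiableAt.differentiableWithinAt) (fun y hy => ?_) hx
        ⟨by linarith, by linarith⟩)
      rw [(hall hy).2.2.deriv, (hall hy).1]
      simp
    have h3 : Tendsto (fun x => (schurPivot S x () ()).re) (𝓝[>] 0)
        (𝓝 (schurPivot S (ε / 2) () ()).re) :=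
      tendsto_const_nhds.congr' (by
        filter_upwards [Ioo_mem_nhdsGT hε'] with x hx using (hconst x hx).symm)
    have := (hall (show ε / 2 ∈ Set.Ioo 0 ε from ⟨by linarith, by linarith⟩)).2.1
    exact this.ne (tendsto_nhds_unique hlim h3)
  obtain ⟨k, g, hg, hg0, hpg⟩ := exists_eq_zpow_smul (fun j => h.meromorphic_schurRow () j) hne
  lift k to ℕ using exponent_nonneg hg.continuousAt hg0 hpg hpos hder
  have hexp : ((k : ℤ) : ℂ) • g 0 = g 0 ᵥ* ((κ : ℂ) • sigma3) := by
    refine leading_exponent hg hpg (p' := fun x => (-(a * schurRow P S x * Jb) + schurRow P S x *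
      nodeQ (fun x => (P x).toRows₁) (fun x => (S x).toBlocks₁₁) x) ())
      -- The block `a` is a scalar, so `-a p J` is absorbed into `Q`; being constant, it leaves the
      -- residue unchanged.
      (Q := fun x => nodeQ (fun x => (P x).toRows₁) (fun x => (S x).toBlocks₁₁) x - a () () • Jb)
      (fun j => ?_) (Eventually.of_forall fun x => ?_) fun i j => ?_
    · filter_upwards [self_mem_nhdsWithin] with x hx using h.deriv_schurRow hx () j
    · ext j
      simp [Matrix.mul_apply, Matrix.vecMul, dotProduct, Fin.sum_univ_two]
      ring
    · have := (hres.sub (hasMatDerivAt_const (a () () • Jb) 0).hasResidue_zero) i j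
      simpa using this
  have hY : HasResidue (fun x => (schurRow P S x)ᴴ * (schurPivot S x)⁻¹ * schurRow P S x)
      (Matrix.of fun i j => (2 * (k : ℂ) + 1) * (star (g 0 i) * g 0 j) /
        ((∑ i, ‖g 0 i‖ ^ 2 : ℝ) : ℂ)) := by
    intro i j
    refine (tendsto_rank_one hg.continuousAt hg0 hpg hder hlim i j).congr' ?_
    filter_upwards [self_mem_nhdsWithin] with x hx
    rw [h.schurPivot_eq_re hx]
    simp [Matrix.mul_apply]
  have hQ := (hres.add (((hY.const_mul Jb).mul_const Jbᴴ).sub hY)).congr'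
    fun x hx => (h.nodeQ_eq hx).symm
  have hn : ∀ z : ℂ, starRingEnd ℂ z * z = (‖z‖ : ℂ) ^ 2 := fun z => Complex.conj_mul' z
  refine ⟨k, g, hg.continuousAt, hg0, hpg, ?_, ?_, fun hz => ?_, fun hz => ?_⟩
  · have := congrFun hexp 0
    simp [sigma3, Matrix.vecMul, dotProduct, Fin.sum_univ_two] at this
    linear_combination this
  · have := congrFun hexp 1
    simp [sigma3, Matrix.vecMul, dotProduct, Fin.sum_univ_two] at this
    linear_combination this
  · have h1 : g 0 0 ≠ 0 := fun h1 => hg0 (by ext j; fin_cases j <;> simp [h1, hz])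
    have h2 : (‖g 0 0‖ : ℂ) ≠ 0 := by simpa using h1
    convert hQ using 1
    rw [Jb_mul_mul_sub]
    ext i j
    fin_cases i <;> fin_cases j <;>
      simp [sigma3, Fin.sum_univ_two, hz, h2, hn] <;> ring
  · have h1 : g 0 1 ≠ 0 := fun h1 => hg0 (by ext j; fin_cases j <;> simp [h1, hz])
    have h2 : (‖g 0 1‖ : ℂ) ≠ 0 := by simpa using h1
    convert hQ using 1
    rw [Jb_mul_mul_sub]
    ext i j
    fin_cases i <;> fin_cases j <;>
      simp [sigma3, Fin.sum_univ_two, hz, h2, hn] <;> ring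

end Step

/-! ### Induction over the rows of the singular part -/

section Induction

theorem IsNode.reindex {n n' : Type} [Fintype n] [Fintype n']
    {A : Matrix n n ℂ} {P : ℝ → Matrix n (Fin 2) ℂ} {S : ℝ → Matrix n n ℂ} (h : IsNode A P S)
    (e : n' ≃ n) : IsNode (A.submatrix e e) (fun x => (P x).submatrix e id)
      (fun x => (S x).submatrix e e) where
  deriv_P x i j := by
    refine HasDerivAt.congr_deriv (h.deriv_P x (e i) j) ?_
    rw [Matrix.submatrix_mul_equiv]
    rfl
  deriv_S x i j := h.deriv_S x (e i) (e j)
  identity x := by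
    rw [Matrix.conjTranspose_submatrix, Matrix.submatrix_mul_equiv, Matrix.submatrix_mul_equiv]
    exact congrArg (fun M => M.submatrix e e) (h.identity x)
  posDef x hx := (h.posDef x hx).submatrix e.injective
  analytic_P i j := h.analytic_P (e i) j
  analytic_S i j := h.analytic_S (e i) (e j)

theorem nodeX_submatrix {n n' : Type} [Fintype n] [Fintype n'] [DecidableEq n] [DecidableEq n']
    (P : ℝ → Matrix n (Fin 2) ℂ) (S : ℝ → Matrix n n ℂ) (e : n' ≃ n) (x : ℝ) :
    nodeX (fun x => (P x).submatrix e id) (fun x => (S x).submatrix e e) x = nodeX P S x := by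
  simp only [nodeX, Matrix.inv_submatrix_equiv, Matrix.conjTranspose_submatrix,
    Matrix.submatrix_mul_equiv, Matrix.submatrix_id_id]

theorem nodeQ_submatrix {n n' : Type} [Fintype n] [Fintype n'] [DecidableEq n] [DecidableEq n']
    (P : ℝ → Matrix n (Fin 2) ℂ) (S : ℝ → Matrix n n ℂ) (e : n' ≃ n) :
    nodeQ (fun x => (P x).submatrix e id) (fun x => (S x).submatrix e e) = nodeQ P S := by
  funext x
  simp only [nodeQ, nodeX_submatrix]

variable {n : Type}

/-- Splitting the last row off. -/
def splitLast (n : Type) (k : ℕ) : (n ⊕ Fin k) ⊕ Unit ≃ n ⊕ Fin (k + 1) :=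
  (Equiv.sumAssoc n (Fin k) Unit).trans
    (Equiv.sumCongr (Equiv.refl n) ((Equiv.optionEquivSumPUnit (Fin k)).symm.trans
      finSuccEquivLast.symm))

@[simp] theorem splitLast_inl_inl (k : ℕ) (i : n) :
    splitLast n k (Sum.inl (Sum.inl i)) = Sum.inl i := rfl

@[simp] theorem splitLast_inl_inr (k : ℕ) (i : Fin k) :
    splitLast n k (Sum.inl (Sum.inr i)) = Sum.inr i.castSucc := by
  simp [splitLast]

@[simp] theorem splitLast_inr (k : ℕ) (u : Unit) :
    splitLast n k (Sum.inr u) = Sum.inr (Fin.last k) := by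
  simp [splitLast]

variable [Fintype n]

/-- Lower triangularity is what permits removing the last row: its column of `A` vanishes above the
diagonal. -/
theorem IsNode.split {k : ℕ} {A : Matrix (n ⊕ Fin (k + 1)) (n ⊕ Fin (k + 1)) ℂ}
    {P : ℝ → Matrix (n ⊕ Fin (k + 1)) (Fin 2) ℂ}
    {S : ℝ → Matrix (n ⊕ Fin (k + 1)) (n ⊕ Fin (k + 1)) ℂ} (h : IsNode A P S)
    (hA₁ : ∀ i j, A (Sum.inl i) (Sum.inr j) = 0)
    (hA₂ : ∀ i j, i < j → A (Sum.inr i) (Sum.inr j) = 0) :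
    IsNode (fromBlocks (A.submatrix (splitLast n k) (splitLast n k)).toBlocks₁₁ 0
      (A.submatrix (splitLast n k) (splitLast n k)).toBlocks₂₁
      (A.submatrix (splitLast n k) (splitLast n k)).toBlocks₂₂)
      (fun x => (P x).submatrix (splitLast n k) id)
      (fun x => (S x).submatrix (splitLast n k) (splitLast n k)) := by
  have h0 : (A.submatrix (splitLast n k) (splitLast n k)).toBlocks₁₂ = 0 := by
    ext i j
    rcases i with i | i
    · simpa [toBlocks₁₂] using hA₁ i (Fin.last k)
    · simpa [toBlocks₁₂] using hA₂ i.castSucc (Fin.last k) (Fin.castSucc_lt_last i)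
  rw [← h0, fromBlocks_toBlocks]
  exact h.reindex (splitLast n k)

variable [DecidableEq n]

theorem det_eq_det_toBlocks₁₁ (M : Matrix (n ⊕ Fin 0) (n ⊕ Fin 0) ℂ) :
    M.det = M.toBlocks₁₁.det := by
  rw [← Matrix.det_submatrix_equiv_self (Equiv.sumEmpty n (Fin 0)).symm]
  rfl

/-- The residue of the potential when the first row of the singular part is `v`. -/
theorem IsNode.hasResidue (k : ℕ) {A : Matrix (n ⊕ Fin (k + 1)) (n ⊕ Fin (k + 1)) ℂ}
    {P : ℝ → Matrix (n ⊕ Fin (k + 1)) (Fin 2) ℂ}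
    {S : ℝ → Matrix (n ⊕ Fin (k + 1)) (n ⊕ Fin (k + 1)) ℂ} (h : IsNode A P S)
    (hA₁ : ∀ i j, A (Sum.inl i) (Sum.inr j) = 0)
    (hA₂ : ∀ i j, i < j → A (Sum.inr i) (Sum.inr j) = 0)
    (hS : (S 0).toBlocks₁₁.det ≠ 0) (hS₂ : ∀ i y, S 0 (Sum.inr i) y = 0)
    (hv : P 0 (Sum.inr 0) ≠ 0) {ε : ℤ}
    (hε : (ε = 1 ∧ P 0 (Sum.inr 0) 0 = 0) ∨ (ε = -1 ∧ P 0 (Sum.inr 0) 1 = 0)) :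
    HasResidue (nodeQ P S) (((ε * (-1) ^ k * (k + 1) : ℤ) : ℂ) • sigma3) := by
  induction k with
  | zero =>
    have hsp := h.split hA₁ hA₂
    have h0 : (S 0).submatrix (splitLast n 0) (splitLast n 0) (Sum.inr ()) (Sum.inr ()) = 0 := by
      simpa using hS₂ (Fin.last 0) _
    have hdet : ((S 0).submatrix (splitLast n 0) (splitLast n 0)).toBlocks₁₁.det ≠ 0 := by
      rw [det_eq_det_toBlocks₁₁]
      exact hS
    have hres := hsp.leading.hasResidue_zero hdet
    obtain ⟨k, g, hg, hg0, hpg, hk0, hk1, hr1, hr0⟩ := hsp.schur_step h0 (κ := 0)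
      (by simpa using hres)
    -- The leading node is regular, `κ = 0`, so the indicial equation reads `k g(0) = 0`.
    have hk : k = 0 := by
      by_contra hk
      have hk' : (k : ℂ) ≠ 0 := by exact_mod_cast hk
      refine hg0 ?_
      ext j
      fin_cases j
      · simpa [hk] using hk0
      · simpa [hk] using hk1
    subst hk
    have hs : HasMatDerivAt (fun t => ((S t).submatrix (splitLast n 0) (splitLast n 0)).toBlocks₂₁)
        _ 0 := fun i j => hsp.deriv_S 0 (Sum.inr i) (Sum.inl j)
    have hp : HasMatDerivAt (fun t => ((P t).submatrix (splitLast n 0) id).toRows₂)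
        _ 0 := fun i j => hsp.deriv_P 0 (Sum.inr i) j
    have hrow := hp.sub ((hs.mul ((hsp.leading.deriv_S 0).inv hdet)).mul (hsp.leading.deriv_P 0))
    have hs0 : ((S 0).submatrix (splitLast n 0) (splitLast n 0)).toBlocks₂₁ = 0 := by
      ext i j
      simpa [toBlocks₂₁] using hS₂ (Fin.last 0) _
    -- With exponent `0` the row is continuous at `0`, and the elimination correction vanishes there
    -- since the lower left block of `S 0` is zero.
    have hgv : ∀ j, g 0 j = P 0 (Sum.inr 0) j := by
      intro j
      have h1 := (hrow () j).continuousAt.tendsto.mono_left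
        (nhdsWithin_le_nhds (s := Set.Ioi (0 : ℝ)))
      have h2 : Tendsto (fun x => g x j) (𝓝[>] 0) (𝓝 (g 0 j)) :=
        (((continuous_apply j).continuousAt.comp hg).tendsto).mono_left nhdsWithin_le_nhds
      refine tendsto_nhds_unique (h2.congr' ?_) (h1.trans (le_of_eq ?_))
      · filter_upwards [hpg] with x hx
        have := congrFun hx j
        simp only [Nat.cast_zero, zpow_zero, one_smul] at this
        exact this.symm
      · simp [hs0, toRows₂]
    rcases hε with ⟨rfl, hv0⟩ | ⟨rfl, hv0⟩
    · have := hr0 (by rw [hgv, hv0])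
      rw [nodeQ_submatrix] at this
      simpa using this
    · have := hr1 (by rw [hgv, hv0])
      rw [nodeQ_submatrix] at this
      simpa using this
  | succ k ih =>
    have hsp := h.split hA₁ hA₂
    have h0 : (S 0).submatrix (splitLast n (k + 1)) (splitLast n (k + 1)) (Sum.inr ()) (Sum.inr ()) = 0 := by
      simpa using hS₂ (Fin.last (k + 1)) _
    have hres := ih hsp.leading (fun i j => by simpa [toBlocks₁₁] using hA₁ i j.castSucc)
      (fun i j hij => by
        simpa [toBlocks₁₁] using hA₂ i.castSucc j.castSucc (Fin.castSucc_lt_castSucc_iff.2 hij))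
      hS (fun i y => by simpa [toBlocks₁₁] using hS₂ i.castSucc _)
      hv hε
    obtain ⟨l, g, hg, hg0, hpg, hl0, hl1, hr1, hr0⟩ := hsp.schur_step h0 hres
    rw [nodeQ_submatrix] at hr0 hr1
    have hsign : ε * (-1) ^ k = 1 ∨ ε * (-1) ^ k = -1 := by
      rcases hε with ⟨rfl, -⟩ | ⟨rfl, -⟩ <;> rcases neg_one_pow_eq_or ℤ k with h | h <;> simp [h]
    rw [pow_succ, ← mul_assoc]
    rcases hsign with hs | hs
    · rw [hs] at hl0 hl1 hr1 ⊢
      -- The residue so far is `k + 1 > 0`, so a nonzero second coordinate would need the exponent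
      -- `-(k + 1)`, which is negative.
      have hg1 : g 0 1 = 0 := by
        have h1 : ((l + k + 1 : ℕ) : ℂ) * g 0 1 = 0 := by
          push_cast at hl1 ⊢
          linear_combination hl1
        exact (mul_eq_zero.1 h1).resolve_left (Nat.cast_ne_zero.2 (Nat.succ_ne_zero _))
      have hgz : g 0 0 ≠ 0 := fun h1 => hg0 (by ext j; fin_cases j <;> simp [h1, hg1])
      have hl : l = k + 1 := by
        have := mul_right_cancel₀ hgz hl0
        push_cast at this
        rw [one_mul] at this
        exact_mod_cast this
      convert hr1 hg1 using 3
      rw [hl]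
      push_cast
      ring
    · rw [hs] at hl0 hl1 hr0 ⊢
      -- Mirror case: the residue is `-(k + 1)`, and the first coordinate is the one excluded.
      have hg1 : g 0 0 = 0 := by
        have h1 : ((l + k + 1 : ℕ) : ℂ) * g 0 0 = 0 := by
          push_cast at hl0 ⊢
          linear_combination hl0
        exact (mul_eq_zero.1 h1).resolve_left (Nat.cast_ne_zero.2 (Nat.succ_ne_zero _))
      have hgz : g 0 1 ≠ 0 := fun h1 => hg0 (by ext j; fin_cases j <;> simp [h1, hg1])
      have hl : l = k + 1 := by
        have := mul_right_cancel₀ hgz hl1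
        push_cast at this
        have h2 : (l : ℂ) = k + 1 := by linear_combination this
        exact_mod_cast h2
      convert hr0 hg1 using 3
      rw [hl]
      push_cast
      ring

end Induction

/-! ### Matrix exponentials and analyticity -/

section Exponential

variable {n : Type} [Fintype n] [DecidableEq n]

section

open scoped Matrix.Norms.Operator

theorem hasDerivAt_exp_smul_apply (A : Matrix n n ℂ) (z : ℂ) (i j : n) :
    HasDerivAt (fun t : ℂ => NormedSpace.exp (t • A) i j) ((A * NormedSpace.exp (z • A)) i j) z :=
  hasDerivAt_pi.1 (hasDerivAt_pi.1 (hasDerivAt_exp_smul_const' (𝕂 := ℂ) A z) i) j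

end

theorem hasMatDerivAt_exp (A : Matrix n n ℂ) (c : ℂ) (x : ℝ) :
    HasMatDerivAt (fun t : ℝ => NormedSpace.exp ((c * (t : ℂ)) • A))
      (c • (A * NormedSpace.exp ((c * (x : ℂ)) • A))) x := by
  intro i j
  have h1 : HasDerivAt (fun t : ℝ => c * (t : ℂ)) c x := by
    simpa using (Complex.ofRealCLM.hasDerivAt (x := x)).const_mul c
  have := (hasDerivAt_exp_smul_apply A (c * (x : ℂ)) i j).scomp x h1
  simpa using! this

theorem differentiable_exp_mul_apply (A : Matrix n n ℂ) (c : ℂ) (i j : n) :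
    Differentiable ℂ (fun z : ℂ => NormedSpace.exp ((c * z) • A) i j) := fun z =>
  (DifferentiableAt.comp z (g := fun t : ℂ => NormedSpace.exp (t • A) i j)
    (hasDerivAt_exp_smul_apply A (c * z) i j).differentiableAt (by fun_prop) :)

/-- Product of entrywise entire matrix functions. -/
theorem differentiable_mul_apply {l m k : Type} [Fintype m] {F : ℂ → Matrix l m ℂ}
    {G : ℂ → Matrix m k ℂ} (hF : ∀ i j, Differentiable ℂ fun z => F z i j)
    (hG : ∀ i j, Differentiable ℂ fun z => G z i j) (i : l) (j : k) :
    Differentiable ℂ fun z => (F z * G z) i j := by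
  simp only [Matrix.mul_apply]
  exact Differentiable.fun_sum fun a _ => (hF i a).mul (hG a j)

theorem analyticAt_ofReal_of_differentiable {g : ℂ → ℂ} (hg : Differentiable ℂ g) (x : ℝ) :
    AnalyticAt ℝ (fun t : ℝ => g t) x :=
  ((hg.analyticAt (x : ℂ)).restrictScalars (𝕜 := ℝ)).comp (Complex.ofRealCLM.analyticAt x)

/-- An entire function has a holomorphic primitive on the unit disc; on the real interval it gives
the integral up to a constant. -/
theorem analyticAt_integral_of_differentiable {g : ℂ → ℂ} (hg : Differentiable ℂ g) :
    AnalyticAt ℝ (fun x : ℝ => ∫ t in (0 : ℝ)..x, g t) 0 := by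
  obtain ⟨F, hF⟩ := (hg.differentiableOn (s := Metric.ball 0 1)).isExactOn_ball
  have hFa : AnalyticAt ℂ F ((0 : ℝ) : ℂ) := by
    refine DifferentiableOn.analyticAt (s := Metric.ball 0 1)
      (fun z hz => (hF z hz).differentiableAt.differentiableWithinAt) ?_
    simpa using Metric.ball_mem_nhds (0 : ℂ) one_pos
  have h1 : AnalyticAt ℝ (fun x : ℝ => F x - F 0) 0 :=
    ((hFa.restrictScalars (𝕜 := ℝ)).comp (Complex.ofRealCLM.analyticAt 0)).sub analyticAt_const
  refine h1.congr ?_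
  filter_upwards [Ioo_mem_nhds (show (-1 : ℝ) < 0 by norm_num) one_pos] with x hx
  have := intervalIntegral.integral_eq_sub_of_hasDerivAt (a := 0) (b := x)
    (f := fun t : ℝ => F t) (f' := fun t : ℝ => g t) (fun t ht => ?_)
    (Continuous.intervalIntegrable (hg.continuous.comp Complex.continuous_ofReal) _ _)
  · simpa using this.symm
  · refine (hF t ?_).comp_ofReal
    have ht' := Set.ordConnected_Ioo.uIcc_subset (show (0 : ℝ) ∈ Set.Ioo (-1) 1 by norm_num) hx ht
    simpa [abs_lt] using ht'

end Exponential

/-! ### The explicit `Π` and `S` form a node -/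

section ConcreteNode

theorem Kb_mul_sigma3 : Kb * sigma3 = Complex.I • (Jb * Kb) := by
  ext i j
  fin_cases i <;> fin_cases j <;>
    simp [Kb, sigma3, Jb, Matrix.mul_apply, Fin.sum_univ_two] <;> ring_nf <;> simp

theorem inv_sqrt_two_mul_self :
    ((Real.sqrt 2 : ℂ)⁻¹) * ((Real.sqrt 2 : ℂ)⁻¹) = 1 / 2 := by
  rw [← mul_inv, ← Complex.ofReal_mul, Real.mul_self_sqrt (by norm_num)]
  norm_num

theorem Kb_conjTranspose_mul_Kb : Kbᴴ * Kb = 1 := by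
  have h := inv_sqrt_two_mul_self
  ext i j
  fin_cases i <;> fin_cases j <;>
    simp [Kb, Matrix.mul_apply, Fin.sum_univ_two, -Complex.ofReal_ofNat]
  · linear_combination 2 * h - (((Real.sqrt 2 : ℂ)⁻¹) * ((Real.sqrt 2 : ℂ)⁻¹)) * Complex.I_sq
  · linear_combination (((Real.sqrt 2 : ℂ)⁻¹) * ((Real.sqrt 2 : ℂ)⁻¹)) * Complex.I_sq
  · linear_combination (((Real.sqrt 2 : ℂ)⁻¹) * ((Real.sqrt 2 : ℂ)⁻¹)) * Complex.I_sq
  · linear_combination 2 * h - (((Real.sqrt 2 : ℂ)⁻¹) * ((Real.sqrt 2 : ℂ)⁻¹)) * Complex.I_sq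

theorem Kb_mul_Kb_conjTranspose : Kb * Kbᴴ = 1 := mul_eq_one_comm.1 Kb_conjTranspose_mul_Kb

theorem sigma3_mul_Kb_conjTranspose : Complex.I • (sigma3 * Kbᴴ) = -(Kbᴴ * Jb) := by
  have : sigma3 * Kbᴴ = Complex.I • (Kbᴴ * Jb) := by
    calc sigma3 * Kbᴴ = Kbᴴ * (Kb * sigma3) * Kbᴴ := by
          rw [← Matrix.mul_assoc, Kb_conjTranspose_mul_Kb, Matrix.one_mul]
      _ = _ := by
          rw [Kb_mul_sigma3, Matrix.mul_smul, Matrix.smul_mul, Matrix.mul_assoc, Matrix.mul_assoc,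
            Kb_mul_Kb_conjTranspose, Matrix.mul_one]
  rw [this, smul_smul, Complex.I_mul_I, neg_one_smul]

variable {n : Type} [Fintype n] [DecidableEq n] (A S₀ : Matrix n n ℂ) (P₀ : Matrix n (Fin 2) ℂ)

/-- The column by column definition becomes a matrix product through the coordinate projections,
which are eigenmatrices of `σ₃` with eigenvalues `1` and `-1`; the opposite signs in the two
exponentials are thus carried by `σ₃`. -/
theorem PiFun_eq (x : ℝ) : PiFun A P₀ x =
    (NormedSpace.exp ((Complex.I * (x : ℂ)) • A) * (P₀ * Kb * Matrix.diagonal ![(1 : ℂ), 0]) +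
      NormedSpace.exp ((-Complex.I * (x : ℂ)) • A) * (P₀ * Kb * Matrix.diagonal ![(0 : ℂ), 1])) * Kbᴴ := by
  rw [PiFun]
  congr 1
  have hθ : ∀ j, theta P₀ j = fun i => (P₀ * Kb) i j := fun _ => rfl
  simp only [hθ]
  generalize P₀ * Kb = Θ
  generalize NormedSpace.exp ((Complex.I * (x : ℂ)) • A) = E
  generalize NormedSpace.exp ((-Complex.I * (x : ℂ)) • A) = G
  rw [← Matrix.mul_assoc, ← Matrix.mul_assoc]
  ext i j
  fin_cases j <;> simp [Matrix.mul_diagonal, Matrix.mulVec, dotProduct, Matrix.mul_apply (M := E),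
    Matrix.mul_apply (M := G)]

theorem deriv_PiFun (x : ℝ) :
    HasMatDerivAt (PiFun A P₀) (-(A * PiFun A P₀ x * Jb)) x := by
  have h := ((((hasMatDerivAt_exp A Complex.I x).mul_const
    (P₀ * Kb * Matrix.diagonal ![(1 : ℂ), 0])).add ((hasMatDerivAt_exp A (-Complex.I) x).mul_const
    (P₀ * Kb * Matrix.diagonal ![(0 : ℂ), 1]))).mul_const Kbᴴ)
  rw [← funext (PiFun_eq A P₀)] at h
  refine h.congr_deriv ?_
  have h1 : P₀ * Kb * Matrix.diagonal ![(1 : ℂ), 0] * sigma3 =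
      P₀ * Kb * Matrix.diagonal ![(1 : ℂ), 0] := by
    rw [Matrix.mul_assoc]
    congr 1
    ext i j; fin_cases i <;> fin_cases j <;> simp [sigma3]
  have h2 : P₀ * Kb * Matrix.diagonal ![(0 : ℂ), 1] * sigma3 =
      -(P₀ * Kb * Matrix.diagonal ![(0 : ℂ), 1]) := by
    rw [Matrix.mul_assoc, ← Matrix.mul_neg]
    congr 1
    ext i j; fin_cases i <;> fin_cases j <;> simp [sigma3]
  rw [PiFun_eq]
  generalize P₀ * Kb * Matrix.diagonal ![(1 : ℂ), 0] = U at h1 ⊢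
  generalize P₀ * Kb * Matrix.diagonal ![(0 : ℂ), 1] = V at h2 ⊢
  generalize NormedSpace.exp ((Complex.I * (x : ℂ)) • A) = E
  generalize NormedSpace.exp ((-Complex.I * (x : ℂ)) • A) = G
  calc (Complex.I • (A * E) * U + -Complex.I • (A * G) * V) * Kbᴴ
      = Complex.I • (A * (E * (U * sigma3) + G * (V * sigma3)) * Kbᴴ) := by
        rw [h1, h2]
        simp only [Matrix.add_mul, Matrix.mul_add, Matrix.smul_mul, Matrix.mul_assoc, neg_smul,
          Matrix.mul_neg, Matrix.neg_mul, smul_add, smul_neg]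
    _ = A * (E * U + G * V) * (Complex.I • (sigma3 * Kbᴴ)) := by
        simp only [Matrix.add_mul, Matrix.mul_add, Matrix.mul_smul, Matrix.mul_assoc, smul_add]
    _ = _ := by
        rw [sigma3_mul_Kb_conjTranspose, Matrix.mul_neg]
        simp only [Matrix.mul_assoc]

theorem PiFun_zero : PiFun A P₀ 0 = P₀ := by
  have h : Matrix.diagonal ![(1 : ℂ), 0] + Matrix.diagonal ![(0 : ℂ), 1] = 1 := by
    ext i j; fin_cases i <;> fin_cases j <;> simp
  rw [PiFun_eq]
  simp only [Complex.ofReal_zero, mul_zero, zero_smul, NormedSpace.exp_zero, Matrix.one_mul]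
  rw [← Matrix.mul_add, h, Matrix.mul_one, Matrix.mul_assoc, Kb_mul_Kb_conjTranspose,
    Matrix.mul_one]

omit [Fintype n] [DecidableEq n] in
theorem mul_diagonal_mul_conjTranspose_apply (Θ : Matrix n (Fin 2) ℂ) (d e : Fin 2 → ℂ) (i j : n) :
    (Θ * Matrix.diagonal d * (Θ * Matrix.diagonal e)ᴴ) i j =
      Θ i 0 * d 0 * star (Θ j 0 * e 0) + Θ i 1 * d 1 * star (Θ j 1 * e 1) := by
  rw [Matrix.mul_apply]
  simp only [Matrix.mul_diagonal, Matrix.conjTranspose_apply, Fin.sum_univ_two]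

/-- `K* K = 1`, and the mixed terms vanish since the two coordinate projections are orthogonal. -/
theorem PiFun_mul_conjTranspose (x : ℝ) : PiFun A P₀ x * (PiFun A P₀ x)ᴴ = SDensity A P₀ x := by
  have e1 : (NormedSpace.exp ((Complex.I * (x : ℂ)) • A))ᴴ =
      NormedSpace.exp ((-Complex.I * (x : ℂ)) • Aᴴ) := by
    rw [← Matrix.exp_conjTranspose, Matrix.conjTranspose_smul]; simp
  have e2 : (NormedSpace.exp ((-Complex.I * (x : ℂ)) • A))ᴴ =
      NormedSpace.exp ((Complex.I * (x : ℂ)) • Aᴴ) := by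
    rw [← Matrix.exp_conjTranspose, Matrix.conjTranspose_smul]; simp
  set Θ := P₀ * Kb with hΘ
  have v1 : Matrix.vecMulVec (theta P₀ 0) (star (theta P₀ 0)) =
      Θ * Matrix.diagonal ![(1 : ℂ), 0] * (Θ * Matrix.diagonal ![(1 : ℂ), 0])ᴴ := by
    ext i j
    rw [mul_diagonal_mul_conjTranspose_apply, Matrix.vecMulVec_apply]
    simp [theta, hΘ]
  have v2 : Matrix.vecMulVec (theta P₀ 1) (star (theta P₀ 1)) =
      Θ * Matrix.diagonal ![(0 : ℂ), 1] * (Θ * Matrix.diagonal ![(0 : ℂ), 1])ᴴ := by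
    ext i j
    rw [mul_diagonal_mul_conjTranspose_apply, Matrix.vecMulVec_apply]
    simp [theta, hΘ]
  have c1 : Θ * Matrix.diagonal ![(1 : ℂ), 0] * (Θ * Matrix.diagonal ![(0 : ℂ), 1])ᴴ = 0 := by
    ext i j
    rw [mul_diagonal_mul_conjTranspose_apply]
    simp
  have c2 : Θ * Matrix.diagonal ![(0 : ℂ), 1] * (Θ * Matrix.diagonal ![(1 : ℂ), 0])ᴴ = 0 := by
    ext i j
    rw [mul_diagonal_mul_conjTranspose_apply]
    simp
  rw [PiFun_eq, SDensity, v1, v2, ← e1, ← e2, ← hΘ]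
  set E := NormedSpace.exp ((Complex.I * (x : ℂ)) • A)
  set G := NormedSpace.exp ((-Complex.I * (x : ℂ)) • A)
  set U := Θ * Matrix.diagonal ![(1 : ℂ), 0]
  set V := Θ * Matrix.diagonal ![(0 : ℂ), 1]
  calc (E * U + G * V) * Kbᴴ * ((E * U + G * V) * Kbᴴ)ᴴ
      = (E * U + G * V) * (Kbᴴ * Kb) * (E * U + G * V)ᴴ := by
        simp only [Matrix.conjTranspose_mul, Matrix.conjTranspose_conjTranspose, Matrix.mul_assoc]
    _ = E * (U * Uᴴ) * Eᴴ + E * (U * Vᴴ) * Gᴴ + G * (V * Uᴴ) * Eᴴ + G * (V * Vᴴ) * Gᴴ := by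
        rw [Kb_conjTranspose_mul_Kb, Matrix.mul_one]
        simp only [Matrix.conjTranspose_add, Matrix.conjTranspose_mul, Matrix.mul_add,
          Matrix.add_mul, Matrix.mul_assoc]
        abel
    _ = _ := by rw [c1, c2]; simp

theorem differentiable_SDensity (i j : n) : Differentiable ℂ fun z : ℂ =>
    (NormedSpace.exp ((Complex.I * z) • A) *
      Matrix.vecMulVec (theta P₀ 0) (star (theta P₀ 0)) *
      NormedSpace.exp ((-Complex.I * z) • A.conjTranspose) +
    NormedSpace.exp ((-Complex.I * z) • A) *
      Matrix.vecMulVec (theta P₀ 1) (star (theta P₀ 1)) *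
      NormedSpace.exp ((Complex.I * z) • A.conjTranspose)) i j := by
  have h : ∀ (c d : ℂ) (V : Matrix n n ℂ), Differentiable ℂ fun z : ℂ =>
      (NormedSpace.exp ((c * z) • A) * V * NormedSpace.exp ((d * z) • Aᴴ)) i j := by
    intro c d V
    have h1 : ∀ i j, Differentiable ℂ fun z : ℂ => (NormedSpace.exp ((c * z) • A) * V) i j := by
      intro i j
      exact differentiable_mul_apply (F := fun z => NormedSpace.exp ((c * z) • A))
        (G := fun _ => V) (differentiable_exp_mul_apply A c)
        (fun _ _ => differentiable_const _) i j
    exact differentiable_mul_apply (F := fun z => NormedSpace.exp ((c * z) • A) * V)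
      (G := fun z => NormedSpace.exp ((d * z) • Aᴴ)) h1 (differentiable_exp_mul_apply Aᴴ d) i j
  exact (h _ _ _).add (h _ _ _)

theorem differentiable_PiFun (i : n) (j : Fin 2) : Differentiable ℂ fun z : ℂ =>
    ((NormedSpace.exp ((Complex.I * z) • A) * (P₀ * Kb * Matrix.diagonal ![(1 : ℂ), 0]) +
      NormedSpace.exp ((-Complex.I * z) • A) * (P₀ * Kb * Matrix.diagonal ![(0 : ℂ), 1])) * Kbᴴ)
      i j := by
  have h : ∀ (c : ℂ) (V : Matrix n (Fin 2) ℂ) (i : n) (j : Fin 2), Differentiable ℂ fun z : ℂ =>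
      (NormedSpace.exp ((c * z) • A) * V) i j := by
    intro c V i j
    exact differentiable_mul_apply (F := fun z => NormedSpace.exp ((c * z) • A))
      (G := fun _ => V) (differentiable_exp_mul_apply A c) (fun _ _ => differentiable_const _) i j
  exact differentiable_mul_apply (F := fun z : ℂ =>
      NormedSpace.exp ((Complex.I * z) • A) * (P₀ * Kb * Matrix.diagonal ![(1 : ℂ), 0]) +
      NormedSpace.exp ((-Complex.I * z) • A) * (P₀ * Kb * Matrix.diagonal ![(0 : ℂ), 1]))
    (G := fun _ => Kbᴴ) (fun i j => (h _ _ i j).add (h _ _ i j))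
    (fun _ _ => differentiable_const _) i j

theorem continuous_SDensity (i j : n) : Continuous fun t => SDensity A P₀ t i j :=
  (differentiable_SDensity A P₀ i j).continuous.comp Complex.continuous_ofReal

theorem deriv_SFun (x : ℝ) : HasMatDerivAt (SFun A S₀ P₀) (PiFun A P₀ x * (PiFun A P₀ x)ᴴ) x := by
  intro i j
  rw [PiFun_mul_conjTranspose]
  exact (intervalIntegral.integral_hasDerivAt_right
    ((continuous_SDensity A P₀ i j).intervalIntegrable _ _)
    ((continuous_SDensity A P₀ i j).stronglyMeasurableAtFilter _ _)
    (continuous_SDensity A P₀ i j).continuousAt).const_add (S₀ i j)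

theorem SFun_zero : SFun A S₀ P₀ 0 = S₀ := by
  ext i j
  simp [SFun]

variable {A S₀ P₀}

/-- The explicit `P`, `S` form a node as soon as the identity holds at `0`. -/
theorem isNode_of_identity (h0 : A * S₀ - S₀ * Aᴴ = P₀ * Jb * P₀ᴴ)
    (hS : ∀ x, 0 < x → (SFun A S₀ P₀ x).PosDef) :
    IsNode A (PiFun A P₀) (SFun A S₀ P₀) where
  deriv_P := deriv_PiFun A P₀
  deriv_S := deriv_SFun A S₀ P₀
  identity x := by
    -- The defect of the identity has zero derivative, by `J² = -1`.
    have hD : ∀ x, HasMatDerivAt (fun t => A * SFun A S₀ P₀ t - SFun A S₀ P₀ t * Aᴴ -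
        PiFun A P₀ t * Jb * (PiFun A P₀ t)ᴴ) 0 x := by
      intro x
      refine ((((deriv_SFun A S₀ P₀ x).const_mul A).sub ((deriv_SFun A S₀ P₀ x).mul_const Aᴴ)).sub
        (((deriv_PiFun A P₀ x).mul_const Jb).mul (deriv_PiFun A P₀ x).conjTranspose)).congr_deriv ?_
      have hJ : Jb * (Jb * (PiFun A P₀ x)ᴴ) = -(PiFun A P₀ x)ᴴ := by
        rw [← Matrix.mul_assoc, Jb_mul_Jb, Matrix.neg_mul, Matrix.one_mul]
      have hJ' : Jb * (Jb * ((PiFun A P₀ x)ᴴ * Aᴴ)) = -((PiFun A P₀ x)ᴴ * Aᴴ) := by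
        rw [← Matrix.mul_assoc, Jb_mul_Jb, Matrix.neg_mul, Matrix.one_mul]
      simp only [Matrix.conjTranspose_neg, Matrix.conjTranspose_mul, Jb_conjTranspose,
        Matrix.neg_mul, Matrix.mul_neg, neg_neg, Matrix.mul_assoc, hJ, hJ']
      abel
    have hc : ∀ i j, (A * SFun A S₀ P₀ x - SFun A S₀ P₀ x * Aᴴ -
        PiFun A P₀ x * Jb * (PiFun A P₀ x)ᴴ) i j = (A * SFun A S₀ P₀ 0 - SFun A S₀ P₀ 0 * Aᴴ -
        PiFun A P₀ 0 * Jb * (PiFun A P₀ 0)ᴴ) i j := fun i j =>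
      is_const_of_deriv_eq_zero (fun y => (hD y i j).differentiableAt)
        (fun y => (hD y i j).deriv) x 0
    rw [← sub_eq_zero]
    ext i j
    rw [hc, SFun_zero, PiFun_zero, h0, sub_self]
  posDef := hS
  analytic_P i j := by
    rw [funext (PiFun_eq A P₀)]
    exact analyticAt_ofReal_of_differentiable (differentiable_PiFun A P₀ i j) 0
  analytic_S i j := analyticAt_const.add
    (analyticAt_integral_of_differentiable (differentiable_SDensity A P₀ i j))

end ConcreteNode

/-! ### Initial data, integrability and the differential equations -/

section MainLemmas

/-- `R` is the solution of `R S₁ = Ψ₂ J Ψ₁*`, the off-diagonal block; the two hypotheses are the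
diagonal blocks. -/
theorem blockA_identity {m k : ℕ} {A₁ S₁ : Matrix (Fin m) (Fin m) ℂ} (hS₁ : S₁.PosDef)
    {A₂ : Matrix (Fin k) (Fin k) ℂ} {Ψ₁ : Matrix (Fin m) (Fin 2) ℂ} {Ψ₂ : Matrix (Fin k) (Fin 2) ℂ}
    (h₁ : A₁ * S₁ - S₁ * A₁ᴴ = Ψ₁ * Jb * Ψ₁ᴴ) (h₂ : Ψ₂ * Jb * Ψ₂ᴴ = 0) :
    blockA A₁ S₁ A₂ Ψ₁ Ψ₂ * blockS k S₁ - blockS k S₁ * (blockA A₁ S₁ A₂ Ψ₁ Ψ₂)ᴴ =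
      blockPi Ψ₁ Ψ₂ * Jb * (blockPi Ψ₁ Ψ₂)ᴴ := by
  have hu : IsUnit S₁.det := isUnit_iff_ne_zero.2 hS₁.det_pos.ne'
  rw [blockA, blockS, blockPi, fromBlocks_conjTranspose, fromBlocks_multiply, fromBlocks_multiply,
    fromRows_mul, conjTranspose_fromRows_eq_fromCols_conjTranspose, fromRows_mul_fromCols,
    sub_eq_add_neg, fromBlocks_neg, fromBlocks_add]
  congr 1
  · simpa [sub_eq_add_neg] using h₁
  · simp only [Matrix.conjTranspose_mul, Matrix.conjTranspose_conjTranspose, Matrix.mul_zero,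
      Matrix.zero_mul, Matrix.conjTranspose_nonsing_inv, hS₁.isHermitian.eq, Jb_conjTranspose,
      add_zero, Matrix.mul_nonsing_inv_cancel_left _ _ hu, zero_add]
    simp [Matrix.mul_assoc]
  · simp [Matrix.nonsing_inv_mul_cancel_right _ _ hu]
  · simpa using h₂.symm

theorem topRow_succ {k : ℕ} (Ψ : Matrix (Fin (k + 1)) (Fin 2) ℂ) : topRow Ψ = Ψ 0 := by
  ext j
  simp [topRow, Matrix.vecMul, dotProduct, Fin.val_eq_zero_iff]

theorem IsNode.hasResidue_sigma3 {m K : ℕ} {κ : ℤ} (hK : κ.natAbs = K)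
    {A₁ S₁ : Matrix (Fin m) (Fin m) ℂ} (hS₁ : S₁.PosDef)
    {A₂ : Matrix (Fin K) (Fin K) ℂ} (hA₂ : ∀ i j, i < j → A₂ i j = 0)
    {Ψ₁ : Matrix (Fin m) (Fin 2) ℂ} {Ψ₂ : Matrix (Fin K) (Fin 2) ℂ} {c : ℂ} (hc : c ≠ 0)
    (h01 : (0 < κ ∧ Odd κ) ∨ (κ < 0 ∧ Even κ) → topRow Ψ₂ = c • ![0, 1])
    (h10 : (0 < κ ∧ Even κ) ∨ (κ < 0 ∧ Odd κ) → topRow Ψ₂ = c • ![1, 0])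
    {P : ℝ → Matrix (Fin m ⊕ Fin K) (Fin 2) ℂ}
    {S : ℝ → Matrix (Fin m ⊕ Fin K) (Fin m ⊕ Fin K) ℂ}
    (h : IsNode (blockA A₁ S₁ A₂ Ψ₁ Ψ₂) P S) (hP : P 0 = blockPi Ψ₁ Ψ₂) (hS : S 0 = blockS K S₁) :
    HasResidue (nodeQ P S) ((κ : ℂ) • sigma3) := by
  have hdet : (S 0).toBlocks₁₁.det ≠ 0 := by
    rw [hS, blockS, toBlocks_fromBlocks₁₁]
    exact hS₁.det_pos.ne'
  cases K with
  | zero =>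
    have := h.hasResidue_zero (by rw [det_eq_det_toBlocks₁₁]; exact hdet)
    simpa [Int.natAbs_eq_zero.1 hK] using this
  | succ k =>
    have hP0 : P 0 (Sum.inr 0) = topRow Ψ₂ := by
      rw [hP, topRow_succ]
      rfl
    -- Here `k + 1 = |κ|`, and `ε` is the residue after the first row. The parity conditions on `κ`
    -- are exactly `ε (-1)ᵏ = sign κ`.
    have hres : ∀ ε : ℤ, ε * (-1) ^ k * (k + 1) = κ → topRow Ψ₂ ≠ 0 →
        ((ε = 1 ∧ topRow Ψ₂ 0 = 0) ∨ (ε = -1 ∧ topRow Ψ₂ 1 = 0)) →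
        HasResidue (nodeQ P S) ((κ : ℂ) • sigma3) := by
      intro ε he hv hε
      rw [← he]
      refine h.hasResidue k (fun i j => rfl) (fun i j hij => hA₂ i j hij) hdet (fun i y => ?_)
        (by rwa [hP0]) (by rwa [hP0])
      rw [hS]
      cases y <;> rfl
    have hv01 : c • ![(0 : ℂ), 1] ≠ 0 := fun h0 => hc (by simpa using congrFun h0 1)
    have hv10 : c • ![(1 : ℂ), 0] ≠ 0 := fun h0 => hc (by simpa using congrFun h0 0)
    have hpar : Even κ ↔ Odd k := by
      rw [← Int.natAbs_even, hK, Nat.even_add_one, Nat.not_even_iff_odd]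
    have hpar' : Odd κ ↔ Even k := by
      rw [← Int.not_even_iff_odd, hpar, Nat.not_odd_iff_even]
    rcases lt_or_gt_of_ne (show κ ≠ 0 by omega) with hκ | hκ
    · have hk : κ = -(k + 1) := by omega
      rcases Int.even_or_odd κ with he | ho
      · have := h01 (Or.inr ⟨hκ, he⟩)
        exact hres 1 (by rw [(hpar.1 he).neg_one_pow, hk]; ring) (this ▸ hv01)
          (Or.inl ⟨rfl, by simp [this]⟩)
      · have := h10 (Or.inr ⟨hκ, ho⟩)
        exact hres (-1) (by rw [(hpar'.1 ho).neg_one_pow, hk]; ring) (this ▸ hv10)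
          (Or.inr ⟨rfl, by simp [this]⟩)
    · have hk : κ = k + 1 := by omega
      rcases Int.even_or_odd κ with he | ho
      · have := h10 (Or.inl ⟨hκ, he⟩)
        exact hres (-1) (by rw [(hpar.1 he).neg_one_pow, hk]; ring) (this ▸ hv10)
          (Or.inr ⟨rfl, by simp [this]⟩)
      · have := h01 (Or.inl ⟨hκ, ho⟩)
        exact hres 1 (by rw [(hpar'.1 ho).neg_one_pow, hk]; ring) (this ▸ hv01)
          (Or.inl ⟨rfl, by simp [this]⟩)

theorem locallyIntegrableOn_Ici_of_bounded {v : ℝ → ℝ} (hv : ContinuousOn v (Set.Ioi 0))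
    {ε C : ℝ} (hε : 0 < ε) (hC : ∀ x, 0 < x → x < ε → |v x| ≤ C) :
    MeasureTheory.LocallyIntegrableOn v (Set.Ici 0) := by
  intro x hx
  rcases (Set.mem_Ici.1 hx).eq_or_lt with rfl | hx0
  · refine ⟨Set.Ico 0 ε, Ico_mem_nhdsGE hε, ?_⟩
    -- The value at `0` is arbitrary but sits on a null set.
    rw [integrableOn_Ico_iff_integrableOn_Ioo]
    refine MeasureTheory.IntegrableOn.of_bound (by simp)
      ((hv.mono fun y hy => hy.1).aestronglyMeasurable measurableSet_Ioo) C ?_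
    filter_upwards [MeasureTheory.ae_restrict_mem measurableSet_Ioo] with y hy
    exact hC y hy.1 hy.2
  · have h1 := hv.locallyIntegrableOn measurableSet_Ioi x hx0 (μ := MeasureTheory.volume)
    rw [nhdsWithin_eq_nhds.2 (Ioi_mem_nhds hx0)] at h1
    exact h1.filter_mono nhdsWithin_le_nhds

variable {n : Type} [Fintype n] [DecidableEq n] {A S₀ : Matrix n n ℂ} {P₀ : Matrix n (Fin 2) ℂ}

theorem IsNode.isHermitian_nodeX {P : ℝ → Matrix n (Fin 2) ℂ} {S : ℝ → Matrix n n ℂ}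
    (h : IsNode A P S) {x : ℝ} (hx : 0 < x) : (nodeX P S x).IsHermitian := by
  rw [nodeX]
  exact Matrix.isHermitian_conjTranspose_mul_mul _ (h.posDef x hx).inv.isHermitian

theorem IsNode.continuousAt_nodeX {P : ℝ → Matrix n (Fin 2) ℂ} {S : ℝ → Matrix n n ℂ}
    (h : IsNode A P S) {x : ℝ} (hx : 0 < x) (i j : Fin 2) :
    ContinuousAt (fun t => nodeX P S t i j) x :=
  (((h.deriv_left hx).mul (h.deriv_P x)) i j).continuousAt

theorem mul_inv_eq_one_of_notMem_spectrum {z : ℂ} (hz : z ∉ spectrum ℂ A) :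
    (A - z • 1) * (A - z • (1 : Matrix n n ℂ))⁻¹ = 1 := by
  rw [spectrum.notMem_iff, ← IsUnit.neg_iff, neg_sub, Algebra.algebraMap_eq_smul_one] at hz
  exact Matrix.mul_nonsing_inv _ ((Matrix.isUnit_iff_isUnit_det _).1 hz)

theorem solvesSystem_uTilde (h : IsNode A (PiFun A P₀) (SFun A S₀ P₀)) {z : ℂ}
    (hz : z ∉ spectrum ℂ A) :
    SolvesSystem (qTilde A S₀ P₀) z fun x => uTilde A S₀ P₀ x z := by
  intro x hx
  have hw := h.deriv_transfer hx _ (mul_inv_eq_one_of_notMem_spectrum hz)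
  have he := hasMatDerivAt_exp sigma3 (-Complex.I * z) x
  have hu := (hw.mul_const Kb).mul he
  refine ⟨_, hu, ?_⟩
  change _ + (z • q1 + qTilde A S₀ P₀ x) * (wA A S₀ P₀ x z * Kb *
    NormedSpace.exp ((-Complex.I * z * (x : ℂ)) • sigma3)) = 0
  change (z • (Jb * wA A S₀ P₀ x z - wA A S₀ P₀ x z * Jb) - qTilde A S₀ P₀ x * wA A S₀ P₀ x z) * Kb *
    NormedSpace.exp ((-Complex.I * z * (x : ℂ)) • sigma3) + wA A S₀ P₀ x z * Kb *
    ((-Complex.I * z) • (sigma3 * NormedSpace.exp ((-Complex.I * z * (x : ℂ)) • sigma3))) + _ = 0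
  generalize NormedSpace.exp ((-Complex.I * z * (x : ℂ)) • sigma3) = E
  generalize wA A S₀ P₀ x z = w
  generalize qTilde A S₀ P₀ x = q
  -- `-i z K σ₃ = z J K`: differentiating the exponential cancels the term `-z w J` of the transfer
  -- equation.
  have h1 : w * Kb * ((-Complex.I * z) • (sigma3 * E)) = z • (w * (Jb * (Kb * E))) := by
    have h2 : (-Complex.I * z) * Complex.I = z := by linear_combination -z * Complex.I_mul_I
    rw [Matrix.mul_smul, Matrix.mul_assoc, ← Matrix.mul_assoc Kb, Kb_mul_sigma3, Matrix.smul_mul,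
      Matrix.mul_smul, smul_smul, h2, Matrix.mul_assoc]
  rw [h1, q1]
  simp only [Matrix.sub_mul, Matrix.add_mul, Matrix.smul_mul, Matrix.mul_assoc, smul_sub,
    Matrix.neg_mul, smul_neg]
  abel

theorem SolvesSystem.solvesRadialDirac {κ : ℤ} {q : ℝ → Matrix (Fin 2) (Fin 2) ℂ} {va vs : ℝ → ℝ}
    {z : ℂ} {u : ℝ → Matrix (Fin 2) (Fin 2) ℂ} (h : SolvesSystem q z u)
    (hq : ∀ x, 0 < x → q x = ((κ : ℂ) / (x : ℂ)) • sigma3 +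
      ((va x : ℂ) • sigma3 - (vs x : ℂ) • sigma1)) :
    SolvesRadialDirac κ (fun _ => 0) va vs z u := by
  intro x hx
  obtain ⟨du, hdu, he⟩ := h x hx
  refine ⟨du, hdu, ?_⟩
  have hdu' : du = -((z • q1 + q x) * u x) := eq_neg_of_add_eq_zero_left he
  have hM : ((-Complex.I) • sigma2) * (z • q1 + q x) = -(z • 1) +
      (((κ : ℂ) / (x : ℂ)) • sigma1 + (((0 : ℝ) : ℂ) • (1 : Matrix (Fin 2) (Fin 2) ℂ) +
        (va x : ℂ) • sigma1 + (vs x : ℂ) • sigma3)) := by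
    rw [hq x hx]
    ext i j
    fin_cases i <;> fin_cases j <;>
      simp [sigma1, sigma2, sigma3, q1, Jb, Matrix.mul_apply, Fin.sum_univ_two] <;> ring
  rw [hdu', Matrix.mul_neg, ← Matrix.mul_assoc, hM, ← sub_eq_zero]
  simp only [Matrix.add_mul, Matrix.neg_mul, Matrix.smul_mul, Matrix.one_mul]
  abel

theorem det_uTilde_ne_zero (h : IsNode A (PiFun A P₀) (SFun A S₀ P₀)) {z : ℂ}
    (hz : z ∉ spectrum ℂ A) (hz' : z ∉ spectrum ℂ Aᴴ) {x : ℝ} (hx : 0 < x) :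
    (uTilde A S₀ P₀ x z).det ≠ 0 := by
  have hw : (wA A S₀ P₀ x z).det ≠ 0 := h.transfer_det_ne_zero hx _ _
    (mul_inv_eq_one_of_notMem_spectrum hz) (mul_inv_eq_one_of_notMem_spectrum hz')
  have hK : Kb.det ≠ 0 := Matrix.det_ne_zero_of_left_inverse Kb_conjTranspose_mul_Kb
  have hE := ((Matrix.isUnit_iff_isUnit_det _).1
    (Matrix.isUnit_exp ((-Complex.I * z * (x : ℂ)) • sigma3))).ne_zero
  rw [uTilde, Matrix.det_mul, Matrix.det_mul]
  exact mul_ne_zero (mul_ne_zero hw hK) hE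

end MainLemmas

end RadialDirac

/-! ### Assembly of the theorem -/

theorem theorem4p1 (κ : ℤ) (m : ℕ) (hm : 0 < m)
    (A₁ S₁ : Matrix (Fin m) (Fin m) ℂ) (hS₁ : S₁.PosDef)
    (A₂ : Matrix (Fin κ.natAbs) (Fin κ.natAbs) ℂ)
    (hA₂ : ∀ i j : Fin κ.natAbs, i < j → A₂ i j = 0)
    (Ψ₁ : Matrix (Fin m) (Fin 2) ℂ) (Ψ₂ : Matrix (Fin κ.natAbs) (Fin 2) ℂ)
    (hnode₁ : A₁ * S₁ - S₁ * A₁.conjTranspose =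
      Ψ₁ * RadialDirac.Jb * Ψ₁.conjTranspose)
    (hnode₂ : Ψ₂ * RadialDirac.Jb * Ψ₂.conjTranspose = 0)
    (c : ℂ) (hc : c ≠ 0)
    (h01 : (0 < κ ∧ Odd κ) ∨ (κ < 0 ∧ Even κ) →
      RadialDirac.topRow Ψ₂ = c • ![0, 1])
    (h10 : (0 < κ ∧ Even κ) ∨ (κ < 0 ∧ Odd κ) →
      RadialDirac.topRow Ψ₂ = c • ![1, 0])
    (A S₀ : Matrix (Fin m ⊕ Fin κ.natAbs) (Fin m ⊕ Fin κ.natAbs) ℂ)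
    (P₀ : Matrix (Fin m ⊕ Fin κ.natAbs) (Fin 2) ℂ)
    (hA : A = RadialDirac.blockA A₁ S₁ A₂ Ψ₁ Ψ₂)
    (hS₀ : S₀ = RadialDirac.blockS κ.natAbs S₁)
    (hP₀ : P₀ = RadialDirac.blockPi Ψ₁ Ψ₂)
    (hS : ∀ x : ℝ, 0 < x → (RadialDirac.SFun A S₀ P₀ x).PosDef) :
    ∃ (Υ : ℝ → Matrix (Fin 2) (Fin 2) ℂ) (va vs : ℝ → ℝ),
      (∀ x : ℝ, 0 < x →
        RadialDirac.qTilde A S₀ P₀ x =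
            ((κ : ℂ) / (x : ℂ)) • RadialDirac.sigma3 + Υ x ∧
        Υ x = (va x : ℂ) • RadialDirac.sigma3 - (vs x : ℂ) • RadialDirac.sigma1 ∧
        (va x : ℂ) = RadialDirac.XFun A S₀ P₀ x 1 1 - RadialDirac.XFun A S₀ P₀ x 0 0
          - (κ : ℂ) / (x : ℂ) ∧
        (vs x : ℂ) = RadialDirac.XFun A S₀ P₀ x 0 1 + RadialDirac.XFun A S₀ P₀ x 1 0) ∧
      (∃ ε > (0 : ℝ), ∃ C : ℝ, ∀ x : ℝ, 0 < x → x < ε →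
        (∀ i j, ‖Υ x i j‖ ≤ C) ∧ |va x| ≤ C ∧ |vs x| ≤ C) ∧
      MeasureTheory.LocallyIntegrableOn va (Set.Ici 0) ∧
      MeasureTheory.LocallyIntegrableOn vs (Set.Ici 0) ∧
      (∀ z : ℂ, z ∉ spectrum ℂ A →
        RadialDirac.SolvesSystem (RadialDirac.qTilde A S₀ P₀) z
          (fun x => RadialDirac.uTilde A S₀ P₀ x z) ∧
        RadialDirac.SolvesRadialDirac κ (fun _ => 0) va vs z
          (fun x => RadialDirac.uTilde A S₀ P₀ x z) ∧
        (z ∉ spectrum ℂ A.conjTranspose →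
          ∀ x : ℝ, 0 < x → (RadialDirac.uTilde A S₀ P₀ x z).det ≠ 0)) := by
  have h0 : A * S₀ - S₀ * A.conjTranspose = P₀ * RadialDirac.Jb * P₀.conjTranspose := by
    rw [hA, hS₀, hP₀]
    exact RadialDirac.blockA_identity hS₁ hnode₁ hnode₂
  have hN := RadialDirac.isNode_of_identity h0 hS
  have hres : RadialDirac.HasResidue (RadialDirac.qTilde A S₀ P₀) ((κ : ℂ) • RadialDirac.sigma3) :=
    RadialDirac.IsNode.hasResidue_sigma3 (A₁ := A₁) rfl hS₁ hA₂ hc h01 h10 (by rwa [← hA])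
      (by rw [RadialDirac.PiFun_zero, hP₀]) (by rw [RadialDirac.SFun_zero, hS₀])
  have hmer : RadialDirac.MatMeromorphic (RadialDirac.XFun A S₀ P₀) := hN.meromorphic_nodeX
  have hherm : ∀ x, 0 < x → (RadialDirac.XFun A S₀ P₀ x).IsHermitian :=
    fun x hx => hN.isHermitian_nodeX hx
  have hcont : ∀ x, 0 < x → ∀ i j, ContinuousAt (fun t => RadialDirac.XFun A S₀ P₀ t i j) x :=
    fun x hx => hN.continuousAt_nodeX hx
  have hqX : ∀ x, RadialDirac.qTilde A S₀ P₀ x = _ :=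
    fun x => RadialDirac.Jb_mul_mul_sub (RadialDirac.XFun A S₀ P₀ x)
  set X := RadialDirac.XFun A S₀ P₀ with hX
  set va : ℝ → ℝ := fun x => (X x 1 1 - X x 0 0).re - (κ : ℝ) / x with hva
  set vs : ℝ → ℝ := fun x => (X x 0 1 + X x 1 0).re with hvs
  have hvaC : ∀ x, 0 < x → (va x : ℂ) = X x 1 1 - X x 0 0 - (κ : ℂ) / (x : ℂ) := by
    intro x hx
    -- Real because `X` is Hermitian for `x > 0`.
    have h1 : ((X x 1 1 - X x 0 0).re : ℂ) = X x 1 1 - X x 0 0 := by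
      refine Complex.conj_eq_iff_re.1 ?_
      rw [map_sub]
      exact congrArg₂ (· - ·) ((hherm x hx).apply 1 1) ((hherm x hx).apply 0 0)
    simp only [hva]
    rw [Complex.ofReal_sub, h1]
    push_cast
    rfl
  have hvsC : ∀ x, 0 < x → (vs x : ℂ) = X x 0 1 + X x 1 0 := by
    intro x hx
    refine Complex.conj_eq_iff_re.1 ?_
    rw [map_add, add_comm]
    exact congrArg₂ (· + ·) ((hherm x hx).apply 0 1) ((hherm x hx).apply 1 0)
  -- The diagonal entry of the residue `κ σ₃` bounds `va`; its zero off-diagonal entry, with `L =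
  -- 0`, bounds `vs`.
  obtain ⟨Ca, hCa⟩ := RadialDirac.MeromorphicAt.exists_bound_sub_div ((hmer 1 1).sub (hmer 0 0))
    (L := κ) (by simpa [hqX, RadialDirac.sigma3] using hres 0 0)
  obtain ⟨Cs, hCs⟩ := RadialDirac.MeromorphicAt.exists_bound_sub_div ((hmer 1 0).neg.sub (hmer 0 1))
    (L := 0) (by simpa [hqX, RadialDirac.sigma3] using hres 0 1)
  obtain ⟨ε, hε, hall⟩ := mem_nhdsGT_iff_exists_Ioo_subset.1 (hCa.and hCs)
  have hε' : (0 : ℝ) < ε := hε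
  have hba : ∀ x, 0 < x → x < ε → |va x| ≤ Ca := by
    intro x hx hxε
    have := (hall ⟨hx, hxε⟩).1
    rw [← Real.norm_eq_abs, ← Complex.norm_real, hvaC x hx]
    exact this
  have hbs : ∀ x, 0 < x → x < ε → |vs x| ≤ Cs := by
    intro x hx hxε
    have h1 := (hall ⟨hx, hxε⟩).2
    rw [← Real.norm_eq_abs, ← Complex.norm_real, hvsC x hx, ← norm_neg]
    refine le_trans (le_of_eq ?_) h1
    congr 1
    simp
    ring
  have hq : ∀ x, 0 < x → RadialDirac.qTilde A S₀ P₀ x =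
      ((κ : ℂ) / (x : ℂ)) • RadialDirac.sigma3 +
        ((va x : ℂ) • RadialDirac.sigma3 - (vs x : ℂ) • RadialDirac.sigma1) := by
    intro x hx
    rw [hqX, hvaC x hx, hvsC x hx]
    ext i j
    fin_cases i <;> fin_cases j <;> simp [RadialDirac.sigma3, RadialDirac.sigma1] <;> ring
  have hsys : ∀ z : ℂ, z ∉ spectrum ℂ A → RadialDirac.SolvesSystem (RadialDirac.qTilde A S₀ P₀) z
      (fun x => RadialDirac.uTilde A S₀ P₀ x z) :=
    fun z hz => RadialDirac.solvesSystem_uTilde hN hz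
  refine ⟨fun x => (va x : ℂ) • RadialDirac.sigma3 - (vs x : ℂ) • RadialDirac.sigma1, va, vs,
    fun x hx => ⟨hq x hx, rfl, hvaC x hx, hvsC x hx⟩, ⟨ε, hε', max Ca Cs, fun x hx hxε =>
      ⟨fun i j => ?_, (hba x hx hxε).trans (le_max_left _ _),
        (hbs x hx hxε).trans (le_max_right _ _)⟩⟩,
    RadialDirac.locallyIntegrableOn_Ici_of_bounded (fun x hx => ?_) hε' hba,
    RadialDirac.locallyIntegrableOn_Ici_of_bounded (fun x hx => ?_) hε' hbs,
    fun z hz => ⟨hsys z hz, (hsys z hz).solvesRadialDirac hq, fun hz' x hx =>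
      RadialDirac.det_uTilde_ne_zero hN hz hz' hx⟩⟩
  · have h1 := (hba x hx hxε).trans (le_max_left Ca Cs)
    have h2 := (hbs x hx hxε).trans (le_max_right Ca Cs)
    generalize max Ca Cs = C at h1 h2 ⊢
    have h3 := (abs_nonneg _).trans h1
    fin_cases i <;> fin_cases j <;> simpa [RadialDirac.sigma3, RadialDirac.sigma1]
  · have hx0 : (0 : ℝ) < x := hx
    refine ContinuousAt.continuousWithinAt ?_
    exact (Complex.continuous_re.continuousAt.comp
      ((hcont x hx0 1 1).sub (hcont x hx0 0 0))).sub (continuousAt_const.div continuousAt_id hx0.ne')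
  · have hx0 : (0 : ℝ) < x := hx
    exact (Complex.continuous_re.continuousAt.comp
      ((hcont x hx0 0 1).add (hcont x hx0 1 0))).continuousWithinAt
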